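/- Let $\mathbb K$ be a field of characteristic different from $2$ and $3$, and let $W=\langle e,f\rangle$ be the $\mathbb Z_2$-graded $\mathbb K$-vector space of dimension $1|1$ with $e$ even and $f$ odd. For $n\ge0$ let $C^n=\mathrm{Hom}(W^{\otimes n},W)$, and for a multi-index $I\in\{e,f\}^n$ and $i\in\{e,f\}$ let $\varphi^I_i\in C^n$ be the map with $\varphi^I_i(w_J)=\delta^I_J\,w_i$ (written $\psi^I_i$ when it is odd); let $e^n$ denote the multi-index $(e,\dots,e)$ of length $n$. For homogeneous $\varphi\in C^k$, $\psi\in C^l$ put $$(\varphi\circ\psi)(w_1\cdots w_{k+l-1})=\sum_{i=0}^{k-1}(-1)^{(|w_1|+\cdots+|w_i|)|\psi|}\varphi\bigl(w_1\cdots w_i\,\psi(w_{i+1}\cdots w_{i+l})\,w_{i+l+1}\cdots w_{k+l-1}\bigr),$$ and let $[\varphi,\psi]=\varphi\circ\psi-(-1)^{|\varphi||\psi|}\psi\circ\varphi$, extended bilinearly. The five odd elements of $C^2$ \begin{align*} d_1&=-\psi_f^{ff}+\psi_e^{ef}-\psi_e^{fe}+\psi_f^{ee}, & d_2&=\psi_f^{ff},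 & d_3&=-\psi_f^{ff}+\psi_e^{ef},\\ d_4&=\psi_f^{ff}+\psi_e^{fe}, & d_5&=-\psi_f^{ff}+\psi_e^{ef}-\psi_e^{fe} \end{align*} are codifferentials, that is, $[d_j,d_j]=0$, so that $D(\varphi)=[d_j,\varphi]$ satisfies $D^2=0$. Their Hochschild cohomology $H^n(d_j)=\ker(D:C^n\to C^{n+1})/\operatorname{Im}(D:C^{n-1}\to C^n)$, where $C^{-1}=0$, is as follows. \begin{itemize} \item $d_1$: $H^0=\langle\psi_f\rangle$ is $1$-dimensional, and $H^n=0$ for all $n\ge1$. \item $d_2$: $H^0=\langle\varphi_e,\psi_f\rangle$ is $2$-dimensional, and $H^n=\langle\varphi^{e^n}_e\rangle$ is $1$-dimensional for all $n\ge1$. \item $d_3$ and $d_4$: $H^n=0$ for all $n\ge0$; in particular $H^2=0$, so both are rigid in the cohomological sense. \item $d_5$: $H^n=\langle\varphi^{e^n}_e,\psi^{e^n}_f\rangle$ is $2$-dimensional for all $n\ge0$. \end{itemize} Here $\langle\cdots\rangle$ means that the listed cochains are cocycles and that their classes form a basis of $H^n$. -/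

import Mathlib

noncomputable section

namespace OneOneAlg

/-- The graded space `W = ⟨e, f⟩` of dimension `1|1`. The coordinate indexed by `0 : ZMod 2` is the
coefficient of the even basis vector `e`, the one indexed by `1` that of the odd basis vector `f`. -/
abbrev W (K : Type*) : Type _ := ZMod 2 → K

/-- The index (and parity) of the even basis vector `e`. -/
abbrev idxE : ZMod 2 := 0

/-- The index (and parity) of the odd basis vector `f`. -/
abbrev idxF : ZMod 2 := 1

/-- `C^n = Hom(W^{⊗ n}, W)`, as multilinear maps. -/
abbrev Cochain (K : Type*) [Field K] (n : ℕ) : Type _ :=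
  MultilinearMap K (fun _ : Fin n => W K) (W K)

variable {K : Type*} [Field K]

/-- The basis vector `w_i` of `W`. -/
def wvec (K : Type*) [Field K] (i : ZMod 2) : W K := Pi.single i 1

/-- The projection of `W` onto its homogeneous part of parity `a`. -/
def gr (K : Type*) [Field K] (a : ZMod 2) : W K →ₗ[K] W K :=
  LinearMap.single K (fun _ : ZMod 2 => K) a ∘ₗ LinearMap.proj a

/-- `koszul K q` multiplies a homogeneous `w` by `(-1)^{|w| q}`. -/
def koszul (K : Type*) [Field K] (q : ZMod 2) : W K →ₗ[K] W K :=
  LinearMap.pi fun a => ((-1 : K) ^ (q.val * a.val)) • LinearMap.proj a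

/-- The homogeneous component of parity `p` of a cochain: the part that maps homogeneous vectors
of parities `J 0, …, J (n-1)` to a vector of parity `p + J 0 + ⋯ + J (n-1)`. -/
def hom {n : ℕ} (p : ZMod 2) : Cochain K n →ₗ[K] Cochain K n where
  toFun φ := ∑ J : Fin n → ZMod 2,
    (gr K (p + ∑ t, J t)).compMultilinearMap (φ.compLinearMap fun t => gr K (J t))
  map_add' φ φ' := by
    ext w
    simp [Finset.sum_add_distrib]
  map_smul' c φ := by
    ext w
    simp [Finset.mul_sum]

/-- The basis cochain `φ^I_i`, which sends `w_J` to `w_i` if `J = I` and to `0` otherwise. -/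
def phi (K : Type*) [Field K] {n : ℕ} (I : Fin n → ZMod 2) (i : ZMod 2) : Cochain K n :=
  ((MultilinearMap.mkPiAlgebra K (Fin n) K).compLinearMap
    fun t => LinearMap.proj (R := K) (φ := fun _ : ZMod 2 => K) (I t)).smulRight (wvec K i)

theorem phi_apply_wvec {n : ℕ} (I J : Fin n → ZMod 2) (i : ZMod 2) :
    phi K I i (fun t => wvec K (J t)) = if I = J then wvec K i else 0 := by
  classical
  by_cases h : I = J
  · subst h
    simp [phi, wvec]
  · obtain ⟨t, ht⟩ := Function.ne_iff.1 h
    have h0 : ∏ s, wvec K (J s) (I s) = 0 :=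
      Finset.prod_eq_zero (Finset.mem_univ t) (by simp [wvec, ht])
    simp [phi, h, h0]

/-- The arguments of `φ` in
`± φ(w_1, …, w_i, ψ(w_{i+1}, …, w_{i+l}), w_{i+l+1}, …, w_m)`, where `k + l = m + 1`;
the Koszul sign `(-1)^{(w_1 + ⋯ + w_i) q}` is distributed over `w_1, …, w_i`. -/
def insertArgs {k l m : ℕ} (h : k + l = m + 1) (i : Fin k) (q : ZMod 2) (ψ : Cochain K l)
    (w : Fin m → W K) (j : Fin k) : W K :=
  if h1 : j.1 < i.1 then koszul K q (w ⟨j.1, by omega⟩)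
  else if h2 : j.1 = i.1 then ψ fun t => w ⟨i.1 + t.1, by omega⟩
  else w ⟨j.1 + l - 1, by omega⟩

theorem insertArgs_update {k l m : ℕ} (h : k + l = m + 1) (i : Fin k) (q : ZMod 2)
    (ψ : Cochain K l) (w : Fin m → W K) (s : Fin m) :
    ∃ (j : Fin k) (L : W K →ₗ[K] W K), ∀ x : W K,
      insertArgs h i q ψ (Function.update w s x) =
        Function.update (insertArgs h i q ψ w) j (L x) := by
  by_cases h1 : s.1 < i.1
  · refine ⟨⟨s.1, by omega⟩, koszul K q, fun x => ?_⟩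
    funext j
    by_cases hj : j = ⟨s.1, by omega⟩
    · subst hj
      simp [insertArgs, h1]
    · have hj' : j.1 ≠ s.1 := fun e => hj (Fin.ext e)
      rw [Function.update_of_ne hj]
      unfold insertArgs
      split_ifs with a b
      · rw [Function.update_of_ne (fun e => hj' (congrArg Fin.val e))]
      · congr 1
        funext t
        rw [Function.update_of_ne (fun e => by have := congrArg Fin.val e; simp at this; omega)]
      · rw [Function.update_of_ne (fun e => by have := congrArg Fin.val e; simp at this; omega)]
  · by_cases h2 : s.1 < i.1 + l
    · refine ⟨i, ψ.toLinearMap (fun t => w ⟨i.1 + t.1, by omega⟩) ⟨s.1 - i.1, by omega⟩,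
        fun x => ?_⟩
      funext j
      by_cases hj : j = i
      · subst hj
        simp only [insertArgs, lt_irrefl, dite_false, dite_true, Function.update_self,
          MultilinearMap.toLinearMap_apply]
        congr 1
        funext t
        by_cases ht : t = ⟨s.1 - j.1, by omega⟩
        · subst ht
          rw [Function.update_self]
          have : (⟨j.1 + (s.1 - j.1), by omega⟩ : Fin m) = s := Fin.ext (by simp; omega)
          rw [this, Function.update_self]
        · rw [Function.update_of_ne ht, Function.update_of_ne]
          intro e
          apply ht
          have := congrArg Fin.val e
          apply Fin.ext
          simp at this ⊢
          omega
      · have hj' : j.1 ≠ i.1 := fun e => hj (Fin.ext e)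
        rw [Function.update_of_ne hj]
        unfold insertArgs
        split_ifs with a
        · rw [Function.update_of_ne (fun e => by have := congrArg Fin.val e; simp at this; omega)]
        · rw [Function.update_of_ne (fun e => by have := congrArg Fin.val e; simp at this; omega)]
    · refine ⟨⟨s.1 + 1 - l, by omega⟩, LinearMap.id, fun x => ?_⟩
      funext j
      by_cases hj : j = ⟨s.1 + 1 - l, by omega⟩
      · subst hj
        rw [Function.update_self]
        unfold insertArgs
        rw [dif_neg (by simp; omega), dif_neg (by simp; omega)]
        have : (⟨s.1 + 1 - l + l - 1, by omega⟩ : Fin m) = s := Fin.ext (by simp; omega)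
        rw [this, Function.update_self]
        rfl
      · have hj' : j.1 ≠ s.1 + 1 - l := fun e => hj (Fin.ext e)
        rw [Function.update_of_ne hj]
        unfold insertArgs
        split_ifs with a b
        · rw [Function.update_of_ne (fun e => by have := congrArg Fin.val e; simp at this; omega)]
        · congr 1
          funext t
          rw [Function.update_of_ne (fun e => by have := congrArg Fin.val e; simp at this; omega)]
        · rw [Function.update_of_ne (fun e => by have := congrArg Fin.val e; simp at this; omega)]

/-- The summand of `φ ∘ ψ` in which `ψ` takes the place of the `i`-th argument of `φ`
(with `i` counted from `0`); here `q` is the parity of `ψ`. -/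
def insertAt {k l m : ℕ} (h : k + l = m + 1) (i : Fin k) (q : ZMod 2)
    (φ : Cochain K k) (ψ : Cochain K l) : Cochain K m where
  toFun w := φ (insertArgs h i q ψ w)
  map_update_add' := by
    intro inst w s x y
    obtain rfl : inst = instDecidableEqFin m := Subsingleton.elim _ _
    obtain ⟨j, L, hL⟩ := insertArgs_update h i q ψ w s
    simp only [hL, map_add, MultilinearMap.map_update_add]
  map_update_smul' := by
    intro inst w s c x
    obtain rfl : inst = instDecidableEqFin m := Subsingleton.elim _ _
    obtain ⟨j, L, hL⟩ := insertArgs_update h i q ψ w s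
    simp only [hL, map_smul, MultilinearMap.map_update_smul]

theorem insertAt_apply {k l m : ℕ} (h : k + l = m + 1) (i : Fin k) (q : ZMod 2)
    (φ : Cochain K k) (ψ : Cochain K l) (w : Fin m → W K) :
    insertAt h i q φ ψ w = φ (insertArgs h i q ψ w) := rfl

/-- The composition `φ ∘ ψ` of (the coderivations given by) `φ` and `ψ`, for `ψ` homogeneous of
parity `q`:
`(φ ∘ ψ)(w_1 ⋯ w_m) = ∑_i (-1)^{(w_1 + ⋯ + w_i) ψ} φ(w_1 ⋯ w_i ψ(w_{i+1} ⋯ w_{i+l}) ⋯ w_m)`. -/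
def circ {k l m : ℕ} (h : k + l = m + 1) (q : ZMod 2)
    (φ : Cochain K k) (ψ : Cochain K l) : Cochain K m :=
  ∑ i : Fin k, insertAt h i q φ ψ

/-- The graded bracket, `[φ, ψ] = φ ∘ ψ - (-1)^{φψ} ψ ∘ φ` for homogeneous `φ` and `ψ`, extended
bilinearly. -/
def bracket {k l m : ℕ} (h : k + l = m + 1) (φ : Cochain K k) (ψ : Cochain K l) : Cochain K m :=
  ∑ p : ZMod 2, ∑ q : ZMod 2,
    (circ h q (hom p φ) (hom q ψ)
      - ((-1 : K) ^ (p.val * q.val)) •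
        circ ((Nat.add_comm l k).trans h) p (hom q ψ) (hom p φ))

theorem circ_add_left {k l m : ℕ} (h : k + l = m + 1) (q : ZMod 2)
    (φ φ' : Cochain K k) (ψ : Cochain K l) :
    circ h q (φ + φ') ψ = circ h q φ ψ + circ h q φ' ψ := by
  ext w
  simp [circ, insertAt_apply, Finset.sum_add_distrib]

theorem circ_smul_left {k l m : ℕ} (h : k + l = m + 1) (q : ZMod 2) (c : K)
    (φ : Cochain K k) (ψ : Cochain K l) :
    circ h q (c • φ) ψ = c • circ h q φ ψ := by
  ext w
  simp [circ, insertAt_apply, Finset.mul_sum]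

theorem insertArgs_eq_update {k l m : ℕ} (h : k + l = m + 1) (i : Fin k) (q : ZMod 2)
    (ψ : Cochain K l) (w : Fin m → W K) :
    insertArgs h i q ψ w = Function.update (insertArgs h i q 0 w) i
      (ψ fun t => w ⟨i.1 + t.1, by omega⟩) := by
  funext j
  by_cases hj : j = i
  · subst hj
    simp [insertArgs]
  · have hj' : j.1 ≠ i.1 := fun e => hj (Fin.ext e)
    rw [Function.update_of_ne hj]
    simp [insertArgs, hj']

theorem circ_add_right {k l m : ℕ} (h : k + l = m + 1) (q : ZMod 2)
    (φ : Cochain K k) (ψ ψ' : Cochain K l) :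
    circ h q φ (ψ + ψ') = circ h q φ ψ + circ h q φ ψ' := by
  simp only [circ, ← Finset.sum_add_distrib]
  refine Finset.sum_congr rfl fun i _ => MultilinearMap.ext fun w => ?_
  simp only [add_apply, insertAt_apply]
  rw [insertArgs_eq_update h i q (ψ + ψ'), insertArgs_eq_update h i q ψ,
    insertArgs_eq_update h i q ψ', add_apply, MultilinearMap.map_update_add]

theorem circ_smul_right {k l m : ℕ} (h : k + l = m + 1) (q : ZMod 2) (c : K)
    (φ : Cochain K k) (ψ : Cochain K l) :
    circ h q φ (c • ψ) = c • circ h q φ ψ := by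
  simp only [circ, Finset.smul_sum]
  refine Finset.sum_congr rfl fun i _ => MultilinearMap.ext fun w => ?_
  simp only [smul_apply, insertAt_apply]
  rw [insertArgs_eq_update h i q (c • ψ), insertArgs_eq_update h i q ψ,
    smul_apply, MultilinearMap.map_update_smul]

/-- The coboundary operator `D(φ) = [d, φ]` from `C^n` to `C^{n+1}`. -/
def coboundary (d : Cochain K 2) (n : ℕ) : Cochain K n →ₗ[K] Cochain K (n + 1) where
  toFun φ := bracket (k := 2) (l := n) (m := n + 1) (Nat.add_comm 2 n) d φ
  map_add' φ φ' := by
    simp only [bracket, ← Finset.sum_add_distrib]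
    refine Finset.sum_congr rfl fun p _ => Finset.sum_congr rfl fun q _ => ?_
    rw [map_add, circ_add_left, circ_add_right, smul_add]
    abel
  map_smul' c φ := by
    simp only [bracket, Finset.smul_sum, RingHom.id_apply]
    refine Finset.sum_congr rfl fun p _ => Finset.sum_congr rfl fun q _ => ?_
    rw [map_smul, circ_smul_left, circ_smul_right, smul_sub, smul_comm c]

/-- A codifferential given by an element of `C^2`: an odd `d` with `[d, d] = 0`. -/
def IsCodifferential (d : Cochain K 2) : Prop :=
  hom 1 d = d ∧ bracket (k := 2) (l := 2) (m := 3) rfl d d = 0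

/-- `n`-cocycles. -/
def cocycles (d : Cochain K 2) (n : ℕ) : Submodule K (Cochain K n) :=
  LinearMap.ker (coboundary d n)

/-- `n`-coboundaries: the image of `C^{n-1}`, where `C^{-1} = 0`. -/
def coboundaries (d : Cochain K 2) : (n : ℕ) → Submodule K (Cochain K n)
  | 0 => ⊥
  | n + 1 => LinearMap.range (coboundary d n)

/-- The quotient `Z / B` of submodules `B ≤ Z` of a module (in general, `Z / (B ⊓ Z)`). -/
abbrev SubQuotient {K M : Type*} [Field K] [AddCommGroup M] [Module K M]
    (Z B : Submodule K M) : Type _ :=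
  Z ⧸ B.submoduleOf Z

/-- The class in `Z / B` of an element of `Z`. -/
def SubQuotient.mk {K M : Type*} [Field K] [AddCommGroup M] [Module K M]
    (Z B : Submodule K M) (x : M) (hx : x ∈ Z) : SubQuotient Z B :=
  Submodule.Quotient.mk ⟨x, hx⟩

/-- `H^n(d) = ker (D : C^n → C^{n+1}) / im (D : C^{n-1} → C^n)`. -/
abbrev Cohomology (d : Cochain K 2) (n : ℕ) : Type _ :=
  SubQuotient (cocycles d n) (coboundaries d n)

/-- The cochains `v i` are cocycles whose classes form a basis of `H^n(d)`. -/
def ClassesFormBasis (d : Cochain K 2) {n : ℕ} {ι : Type*} (v : ι → Cochain K n) : Prop :=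
  ∃ b : Module.Basis ι K (Cohomology d n), ∀ i, ∃ hi : v i ∈ cocycles d n,
    b i = SubQuotient.mk (cocycles d n) (coboundaries d n) (v i) hi

/-- Rigidity in the cohomological sense: `H^2(d) = 0`. -/
def CohomologicallyRigid (d : Cochain K 2) : Prop := Subsingleton (Cohomology d 2)

/-- The multi-index `e^n = (e, …, e)`. -/
def ePow (n : ℕ) : Fin n → ZMod 2 := fun _ => idxE

/-- `d_1 = -ψ_f^{ff} + ψ_e^{ef} - ψ_e^{fe} + ψ_f^{ee}` -/
def d1 (K : Type*) [Field K] : Cochain K 2 :=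
  -phi K ![idxF, idxF] idxF + phi K ![idxE, idxF] idxE - phi K ![idxF, idxE] idxE
    + phi K ![idxE, idxE] idxF

/-- `d_2 = ψ_f^{ff}` -/
def d2 (K : Type*) [Field K] : Cochain K 2 := phi K ![idxF, idxF] idxF

/-- `d_3 = -ψ_f^{ff} + ψ_e^{ef}` -/
def d3 (K : Type*) [Field K] : Cochain K 2 :=
  -phi K ![idxF, idxF] idxF + phi K ![idxE, idxF] idxE

/-- `d_4 = ψ_f^{ff} + ψ_e^{fe}` -/
def d4 (K : Type*) [Field K] : Cochain K 2 :=
  phi K ![idxF, idxF] idxF + phi K ![idxF, idxE] idxE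

/-- `d_5 = -ψ_f^{ff} + ψ_e^{ef} - ψ_e^{fe}` -/
def d5 (K : Type*) [Field K] : Cochain K 2 :=
  -phi K ![idxF, idxF] idxF + phi K ![idxE, idxF] idxE - phi K ![idxF, idxE] idxE

end OneOneAlg

end

/-!
The five codifferentials all have the form `d (w_a, w_b) = m a b • w_{a + b + 1}`, with structure
constants `d (e, e) = t f`, `d (e, f) = c e`, `d (f, e) = c' e` and `d (f, f) = k f`, `k = ±1`
(`ofStruct`, `structConst`). Up to signs this is an associative algebra with an odd generator `e`
in which `f` is idempotent, and `D` is its Hochschild differential.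

A cochain is determined by its values at words in the letters `e` and `f`, which are lists of `0`
(for `e`) and `1` (for `f`). With a twist by the
parity of the cochain (`onWords`), `D` becomes an operator `wordDiff` on functions of words, which
is recursive in the first letter (`coboundary_apply_wvec`), and `D ∘ D = 0` is an induction on the
word (`wordDiff_wordDiff`). The operator makes sense for values in any bimodule.

The idea of the computation is normalization with respect to the idempotent `f`. If `F` is a
cocycle, then inserting `f` in the first place, followed by the involution `2 λ_f - k`, where `λ_f`
is the left action of `f`, gives a function whose differential agrees with `F` at the words
`f ⋯` (`wordDiff_homotopy`). Once `F` vanishes there, `F (e ⋯)` is a cocycle for a new bimodule, in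
which `f` acts from the left by the scalar `-c`, and the cocycle condition at the words `f e ⋯`
says that the values of `F` lie in the eigenspace of `λ_f` for `c'`.

* If `f` is a unit up to sign (`d_1`, `d_5`), the new bimodule is the old one. By induction, every
  cocycle is cohomologous to one that vanishes at all words that contain `f`
  (`exists_wordDiff_eq_of_mem`), that is, to a combination of `φ^{e^n}_e` and `ψ^{e^n}_f`. On these
  `D` is zero if `t = 0`, and sends `φ^{e^n}_e` to `±2 ψ^{e^{n+1}}_f` if `t = 1`
  (`wordDiff_normalized`).
* If `f` annihilates `e` on both sides (`d_2`), the same induction applies to the new bimodule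
  (`exists_wordDiff_eq_of_mem_of_annihilated`), and the eigenspace condition leaves `φ^{e^n}_e`.
* If `c + c' ≠ 0` (`d_3`, `d_4`), then `f` acts on `e` by different eigenvalues from the two sides.
  After one more normalization step the cocycle condition at the words `e f e ⋯` shows that nothing
  is left in degrees at least two (`exists_wordDiff_eq_of_ne`); degrees zero and one are explicit.

When `t = 0` and `c' = -c`, all coboundaries vanish at `e ⋯ e`
(`onWords_replicate_of_mem_coboundaries`), which gives the independence of the classes.
-/

noncomputable section

namespace OneOneAlg

variable {K : Type*} [Field K] {M N : Type*} [AddCommGroup M] [Module K M]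
  [AddCommGroup N] [Module K N]

/-! ### Signs -/

theorem zmod_two_cases (a : ZMod 2) : a = 0 ∨ a = 1 := by
  revert a
  decide

/-- The sign `(-1)^a` of a parity `a`. -/
def sgn (K : Type*) [Field K] (a : ZMod 2) : K := (-1) ^ a.val

@[simp] theorem sgn_zero : sgn K 0 = 1 := by simp [sgn]

@[simp] theorem sgn_one : sgn K 1 = -1 := by simp [sgn, ZMod.val_one]

theorem sgn_add (a b : ZMod 2) : sgn K (a + b) = sgn K a * sgn K b := by
  rcases zmod_two_cases a with rfl | rfl <;> rcases zmod_two_cases b with rfl | rfl <;>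
    simp [CharTwo.add_self_eq_zero]

theorem sgn_mul_self (a : ZMod 2) : sgn K a * sgn K a = 1 := by
  rcases zmod_two_cases a with rfl | rfl <;> simp

/-! ### Differentials on functions of words -/

/-- The part of the differential on functions of words that does not involve the left action:
`wordRight m ρ F` is the signed right action of the last letter minus the signed sum of the values
of `F` at the words in which two neighbouring letters `w`, `v` are replaced by their product
`m w v • (w + v + 1)`. The recursion splits off the first letter. -/
def wordRight (m : ZMod 2 → ZMod 2 → K) (ρ : ZMod 2 → M →ₗ[K] M) :
    (List (ZMod 2) → M) → List (ZMod 2) → M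
  | _, [] => 0
  | F, [w] => ρ w (F [])
  | F, w :: v :: I =>
      -(m w v • F ((w + v + 1) :: I)) + sgn K w • wordRight m ρ (fun J => F (w :: J)) (v :: I)

/-- The Hochschild differential on functions of words with values in a module `M` on which the
letters act by `lam` from the left and by `ρ` from the right. -/
def wordDiff (m : ZMod 2 → ZMod 2 → K) (lam ρ : ZMod 2 → M →ₗ[K] M)
    (F : List (ZMod 2) → M) : List (ZMod 2) → M
  | [] => 0
  | w :: I => wordRight m ρ F (w :: I) + sgn K ((w + 1) * I.sum) • lam w (F I)

section Words

variable {m : ZMod 2 → ZMod 2 → K} {lam ρ : ZMod 2 → M →ₗ[K] M} {ρ' : ZMod 2 → N →ₗ[K] N}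

@[simp] theorem wordRight_nil (F : List (ZMod 2) → M) : wordRight m ρ F [] = 0 := by
  simp [wordRight]

@[simp] theorem wordRight_singleton (F : List (ZMod 2) → M) (w : ZMod 2) :
    wordRight m ρ F [w] = ρ w (F []) := by
  simp [wordRight]

theorem wordRight_cons_cons (F : List (ZMod 2) → M) (w v : ZMod 2) (I : List (ZMod 2)) :
    wordRight m ρ F (w :: v :: I) = -(m w v • F ((w + v + 1) :: I)) +
      sgn K w • wordRight m ρ (fun J => F (w :: J)) (v :: I) := by
  simp [wordRight]

@[simp] theorem wordDiff_nil (F : List (ZMod 2) → M) : wordDiff m lam ρ F [] = 0 := rfl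

theorem wordDiff_cons (F : List (ZMod 2) → M) (w : ZMod 2) (I : List (ZMod 2)) :
    wordDiff m lam ρ F (w :: I) =
      wordRight m ρ F (w :: I) + sgn K ((w + 1) * I.sum) • lam w (F I) := rfl

/-- The value at a word only depends on the values of `F` at the words that are one shorter. -/
theorem wordRight_congr {I : List (ZMod 2)} : ∀ {F F' : List (ZMod 2) → M},
    (∀ J : List (ZMod 2), J.length + 1 = I.length → F J = F' J) →
      wordRight m ρ F I = wordRight m ρ F' I := by
  induction I with
  | nil => intro F F' _; simp
  | cons w I ih =>
    intro F F' h
    cases I with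
    | nil => simp [h [] rfl]
    | cons v I =>
      rw [wordRight_cons_cons, wordRight_cons_cons, h _ (by simp),
        ih (F := fun J => F (w :: J)) fun J hJ => h _ (by simp at hJ ⊢; omega)]

theorem wordDiff_congr {I : List (ZMod 2)} {F F' : List (ZMod 2) → M}
    (h : ∀ J : List (ZMod 2), J.length + 1 = I.length → F J = F' J) :
    wordDiff m lam ρ F I = wordDiff m lam ρ F' I := by
  cases I with
  | nil => rfl
  | cons w I => rw [wordDiff_cons, wordDiff_cons, wordRight_congr h, h I rfl]

theorem wordRight_add (F F' : List (ZMod 2) → M) (I : List (ZMod 2)) :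
    wordRight m ρ (fun J => F J + F' J) I = wordRight m ρ F I + wordRight m ρ F' I := by
  induction I generalizing F F' with
  | nil => simp
  | cons w I ih =>
    cases I with
    | nil => simp
    | cons v I =>
      rw [wordRight_cons_cons, wordRight_cons_cons, wordRight_cons_cons,
        ih (fun J => F (w :: J)) fun J => F' (w :: J)]
      module

/-- A linear map that intertwines the right actions commutes with `wordRight`. -/
theorem wordRight_map (A : M →ₗ[K] N) (hA : ∀ w x, A (ρ w x) = ρ' w (A x))
    (F : List (ZMod 2) → M) (I : List (ZMod 2)) :
    wordRight m ρ' (fun J => A (F J)) I = A (wordRight m ρ F I) := by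
  induction I generalizing F with
  | nil => simp
  | cons w I ih =>
    cases I with
    | nil => simp [hA]
    | cons v I =>
      rw [wordRight_cons_cons, wordRight_cons_cons, ih fun J => F (w :: J)]
      simp

/-- As merging two letters changes the parity of a word, multiplication by the sign of the word
anticommutes with `wordRight`. -/
theorem wordRight_sgn_map (A : M →ₗ[K] M) (hA : ∀ w x, ρ w (A x) = -(sgn K w • A (ρ w x)))
    (F : List (ZMod 2) → M) (I : List (ZMod 2)) :
    wordRight m ρ (fun J => sgn K J.sum • A (F J)) I =
      -(sgn K I.sum • A (wordRight m ρ F I)) := by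
  induction I generalizing F with
  | nil => simp
  | cons w I ih =>
    cases I with
    | nil => simp [hA]
    | cons v I =>
      have h1 : (fun J : List (ZMod 2) => sgn K (w :: J).sum • A (F (w :: J))) =
          fun J => sgn K J.sum • (sgn K w • A) (F (w :: J)) := by
        funext J
        rw [List.sum_cons, sgn_add, LinearMap.smul_apply, smul_smul, mul_comm]
      have h2 := ih (fun J => sgn K w • F (w :: J))
      simp only [map_smul] at h2
      have h3 := wordRight_map (m := m) (ρ := ρ) (ρ' := ρ) (sgn K w • LinearMap.id)
        (by simp) (fun J => F (w :: J)) (v :: I)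
      simp only [LinearMap.smul_apply, LinearMap.id_apply] at h3
      rw [wordRight_cons_cons, h1]
      simp only [LinearMap.smul_apply]
      rw [h2, h3, wordRight_cons_cons]
      simp only [List.sum_cons, sgn_add, map_add, map_neg, map_smul, sgn_one]
      module

theorem wordRight_zero (I : List (ZMod 2)) : wordRight m ρ (fun _ => 0) I = 0 := by
  simpa using wordRight_map (m := m) (ρ := ρ) (ρ' := ρ) 0 (by simp) (fun _ => 0) I

theorem wordRight_smul (a : K) (F : List (ZMod 2) → M) (I : List (ZMod 2)) :
    wordRight m ρ (fun J => a • F J) I = a • wordRight m ρ F I := by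
  exact wordRight_map (m := m) (ρ := ρ) (ρ' := ρ) (a • LinearMap.id) (by simp) F I

theorem wordDiff_add (F F' : List (ZMod 2) → M) (I : List (ZMod 2)) :
    wordDiff m lam ρ (fun J => F J + F' J) I =
      wordDiff m lam ρ F I + wordDiff m lam ρ F' I := by
  cases I with
  | nil => simp
  | cons w I =>
    simp only [wordDiff_cons, wordRight_add, map_add]
    module

theorem wordDiff_smul (a : K) (F : List (ZMod 2) → M) (I : List (ZMod 2)) :
    wordDiff m lam ρ (fun J => a • F J) I = a • wordDiff m lam ρ F I := by
  cases I with
  | nil => simp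
  | cons w I =>
    simp only [wordDiff_cons, wordRight_smul, map_smul]
    module

theorem wordDiff_sub (F F' : List (ZMod 2) → M) (I : List (ZMod 2)) :
    wordDiff m lam ρ (fun J => F J - F' J) I =
      wordDiff m lam ρ F I - wordDiff m lam ρ F' I := by
  have h := wordDiff_add (m := m) (lam := lam) (ρ := ρ) F (fun J => (-1 : K) • F' J) I
  rw [wordDiff_smul] at h
  simpa [sub_eq_add_neg] using h

/-- The structure constants `m` define an associative algebra, in the sign convention of
codifferentials: `d (d (w, v), u) + (-1)^w d (w, d (v, u)) = 0`. -/
def IsAssoc (m : ZMod 2 → ZMod 2 → K) : Prop :=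
  ∀ w v u, m w v * m (w + v + 1) u + sgn K w * (m v u * m w (v + u + 1)) = 0

/-- The letters act on `M` as on a bimodule over the algebra with structure constants `m`; the
signs are those of `wordDiff`. -/
structure IsBimod (m : ZMod 2 → ZMod 2 → K) (lam ρ : ZMod 2 → M →ₗ[K] M) : Prop where
  right : ∀ w v x, ρ v (ρ w x) = (sgn K w * m w v) • ρ (w + v + 1) x
  left : ∀ w v x, sgn K ((w + 1) * v) • lam w (lam v x) = m w v • lam (w + v + 1) x
  comm : ∀ w v x, ρ v (lam w x) = sgn K ((w + 1) * (v + 1)) • lam w (ρ v x)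

theorem wordRight_wordRight (hm : IsAssoc m)
    (hρ : ∀ w v x, ρ v (ρ w x) = (sgn K w * m w v) • ρ (w + v + 1) x)
    (F : List (ZMod 2) → M) (I : List (ZMod 2)) :
    wordRight m ρ (wordRight m ρ F) I = 0 := by
  induction I generalizing F with
  | nil => simp
  | cons w I ih =>
    cases I with
    | nil => simp
    | cons v I =>
      cases I with
      | nil =>
        simp only [wordRight_cons_cons, wordRight_singleton, hρ]
        linear_combination (norm := module)
          (sgn_mul_self (K := K) w) • (m w v • ρ (w + v + 1) (F []))
      | cons u I =>
        have h1 : (fun J => wordRight m ρ F (w :: v :: J)) = fun J =>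
            (-m w v) • F ((w + v + 1) :: J) +
              sgn K w • wordRight m ρ (fun J => F (w :: J)) (v :: J) := by
          funext J
          rw [wordRight_cons_cons, neg_smul]
        have h2 := ih (fun J => F (w :: J))
        rw [wordRight_cons_cons] at h2
        have e1 : w + v + 1 + u + 1 = w + v + u := by
          linear_combination CharTwo.two_eq_zero (R := ZMod 2)
        have e2 : w + (v + u + 1) + 1 = w + v + u := by
          linear_combination CharTwo.two_eq_zero (R := ZMod 2)
        rw [wordRight_cons_cons, wordRight_cons_cons (F := F), wordRight_cons_cons, h1,
          wordRight_cons_cons (F := F), wordRight_add, wordRight_smul, wordRight_smul, e1, e2]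
        simp only [sgn_add, sgn_one]
        have h3 := hm w v u
        linear_combination (norm := module) h3 • F ((w + v + u) :: I) + (sgn K w * sgn K w) • h2

theorem wordRight_left (hM : IsBimod m lam ρ) (w : ZMod 2) (F : List (ZMod 2) → M)
    (I : List (ZMod 2)) :
    wordRight m ρ (fun J => sgn K ((w + 1) * J.sum) • lam w (F J)) I =
      (sgn K (w + 1) * sgn K ((w + 1) * I.sum)) • lam w (wordRight m ρ F I) := by
  rcases zmod_two_cases w with rfl | rfl
  · have h := wordRight_sgn_map (m := m) (ρ := ρ) (lam 0) (fun v x => by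
      rw [hM.comm, zero_add, one_mul, sgn_add, sgn_one]
      module) F I
    simpa using h
  · have h := wordRight_map (m := m) (ρ := ρ) (ρ' := ρ) (lam 1) (fun v x => by
      rw [hM.comm]
      simp [CharTwo.add_self_eq_zero]) F I
    simpa [CharTwo.add_self_eq_zero] using h

theorem wordDiff_wordDiff (hm : IsAssoc m) (hM : IsBimod m lam ρ)
    (F : List (ZMod 2) → M) (I : List (ZMod 2)) :
    wordDiff m lam ρ (wordDiff m lam ρ F) I = 0 := by
  cases I with
  | nil => rfl
  | cons w I =>
    cases I with
    | nil => simp [wordDiff_cons]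
    | cons v I =>
      have h0 := wordRight_wordRight hm hM.right F (w :: v :: I)
      have h1 : (fun J => wordDiff m lam ρ F (w :: J)) = fun J =>
          wordRight m ρ F (w :: J) + sgn K ((w + 1) * J.sum) • lam w (F J) := rfl
      rw [wordRight_cons_cons] at h0
      rw [wordDiff_cons, wordRight_cons_cons, h1, wordRight_add, wordRight_left hM,
        wordDiff_cons, wordDiff_cons]
      have h2 := hM.left w v (F I)
      have e : sgn K ((w + 1) * (v + I.sum)) * sgn K ((v + 1) * I.sum) =
          sgn K ((w + 1) * v) * sgn K ((w + v + 1 + 1) * I.sum) := by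
        rw [← sgn_add, ← sgn_add]
        congr 1
        ring
      simp only [List.sum_cons, map_add, map_smul]
      have e2 : sgn K w * sgn K (w + 1) = -1 := by
        rw [sgn_add, ← mul_assoc, sgn_mul_self, sgn_one, one_mul]
      linear_combination (norm := module) h0 + e • lam w (lam v (F I)) +
        sgn K ((w + v + 1 + 1) * I.sum) • h2 +
        e2 • sgn K ((w + 1) * (v + I.sum)) • lam w (wordRight m ρ F (v :: I))

end Words

/-! ### Cochains as functions of words -/

theorem sum_zmod_two {A : Type*} [AddCommMonoid A] (f : ZMod 2 → A) :
    ∑ a, f a = f 0 + f 1 := Fin.sum_univ_two f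

theorem exists_ofFn_eq {A : Type*} {n : ℕ} {I : List A} (hI : I.length = n) :
    ∃ J : Fin n → A, List.ofFn J = I := by
  subst hI
  exact ⟨I.get, List.ofFn_get I⟩

/-- The word `J` with the letters at the positions `i` and `i + 1` replaced by their product. -/
def mergeAt {n : ℕ} (J : Fin (n + 1) → ZMod 2) (i j : Fin n) : ZMod 2 :=
  if j < i then J j.castSucc else if j = i then J i.castSucc + J i.succ + 1 else J j.succ

/-- The non-recursive form of `wordRight`. -/
theorem wordRight_ofFn (m : ZMod 2 → ZMod 2 → K) (ρ : ZMod 2 → M →ₗ[K] M) {n : ℕ}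
    (F : List (ZMod 2) → M) (J : Fin (n + 1) → ZMod 2) :
    wordRight m ρ F (List.ofFn J) =
      sgn K (∑ t : Fin n, J t.castSucc) •
        ρ (J (Fin.last n)) (F (List.ofFn fun t : Fin n => J t.castSucc)) -
      ∑ i : Fin n, ((∏ j : Fin n, if j < i then sgn K (J j.castSucc) else 1) *
        m (J i.castSucc) (J i.succ)) • F (List.ofFn (mergeAt J i)) := by
  induction n generalizing F with
  | zero => simp
  | succ n ih =>
    have h := ih (fun I => F (J 0 :: I)) fun t => J t.succ
    have hJ : List.ofFn J = J 0 :: J 1 :: List.ofFn fun t : Fin n => J t.succ.succ := by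
      simp [List.ofFn_succ]
    have hJ' : (List.ofFn fun t : Fin (n + 1) => J t.succ) =
        J 1 :: List.ofFn fun t : Fin n => J t.succ.succ := by
      simp [List.ofFn_succ]
    have h0 : List.ofFn (mergeAt J 0) =
        (J 0 + J 1 + 1) :: List.ofFn fun t : Fin n => J t.succ.succ := by
      rw [List.ofFn_succ]
      congr 1
    have hs : ∀ i : Fin n, List.ofFn (mergeAt J i.succ) =
        J 0 :: List.ofFn (mergeAt (fun t => J t.succ) i) := by
      intro i
      rw [List.ofFn_succ]
      congr 1
      congr 1
      funext t
      simp [mergeAt]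
    rw [hJ'] at h
    rw [hJ, wordRight_cons_cons, h, Fin.sum_univ_succ (n := n), Fin.sum_univ_succ (n := n), h0]
    simp only [hs, Fin.prod_univ_succ, List.ofFn_succ]
    simp only [sgn_add, Fin.castSucc_zero, Fin.succ_lt_succ_iff, Fin.succ_pos, if_true,
      Fin.not_lt_zero, if_false, Finset.prod_const_one, ← Fin.succ_castSucc, Fin.succ_last,
      Fin.succ_zero_eq_one, mul_assoc, mul_smul, ← Finset.smul_sum]
    module

/-- The element of `C^2` with `w_a ⊗ w_b ↦ m a b • w_{a + b + 1}`; every odd element of `C^2` is of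
this form. -/
def ofStruct (m : ZMod 2 → ZMod 2 → K) : Cochain K 2 :=
  ∑ a, ∑ b, m a b • phi K ![a, b] (a + b + 1)

/-- The left action of the letters on `W`. The signs are those for which `wordDiff` describes `D`:
`w` sends `w_a` to `(-1)^{a (w + 1)} d (w, w_a)`. -/
def lamW (m : ZMod 2 → ZMod 2 → K) (w : ZMod 2) : W K →ₗ[K] W K :=
  LinearMap.pi fun b =>
    (sgn K ((w + b + 1) * (w + 1)) * m w (w + b + 1)) • LinearMap.proj (w + b + 1)

/-- The right action of the letters on `W`. The signs are those for which `wordDiff` describes `D`: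
`w` sends `w_a` to `(-1)^a d (w_a, w)`. -/
def rhoW (m : ZMod 2 → ZMod 2 → K) (w : ZMod 2) : W K →ₗ[K] W K :=
  LinearMap.pi fun b =>
    (sgn K (w + b + 1) * m (w + b + 1) w) • LinearMap.proj (w + b + 1)

theorem lamW_apply (m : ZMod 2 → ZMod 2 → K) (w b : ZMod 2) (x : W K) :
    lamW m w x b = sgn K ((w + b + 1) * (w + 1)) * m w (w + b + 1) * x (w + b + 1) := rfl

theorem rhoW_apply (m : ZMod 2 → ZMod 2 → K) (w b : ZMod 2) (x : W K) :
    rhoW m w x b = sgn K (w + b + 1) * m (w + b + 1) w * x (w + b + 1) := rfl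

/-- The parity involution of `W`. -/
def parityW (K : Type*) [Field K] : W K →ₗ[K] W K :=
  LinearMap.pi fun b => sgn K b • LinearMap.proj b

@[simp] theorem parityW_apply (x : W K) (b : ZMod 2) : parityW K x b = sgn K b * x b := rfl

/-- The values of a cochain at the words of basis vectors, twisted by the parity `p` of the cochain:
the component of parity `b` of the value at `I` is multiplied by `(-1)^{|I| + b} = (-1)^p`. Words of
a length other than `n` are truncated or filled up with `e`; their values do not matter. -/
def onWords {n : ℕ} (φ : Cochain K n) (I : List (ZMod 2)) : W K :=
  sgn K I.sum • parityW K (φ fun t => wvec K (I.getD t 0))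

theorem onWords_ofFn {n : ℕ} (φ : Cochain K n) (J : Fin n → ZMod 2) :
    onWords φ (List.ofFn J) = sgn K (∑ t, J t) • parityW K (φ fun t => wvec K (J t)) := by
  simp [onWords, List.sum_ofFn]

theorem parityW_parityW (x : W K) : parityW K (parityW K x) = x := by
  funext b
  simp [← mul_assoc, sgn_mul_self]

theorem cochain_ext {n : ℕ} {φ ψ : Cochain K n}
    (h : ∀ J : Fin n → ZMod 2, (φ fun t => wvec K (J t)) = ψ fun t => wvec K (J t)) : φ = ψ := by
  refine Module.Basis.ext_multilinear (fun _ => Pi.basisFun K (ZMod 2)) fun J => ?_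
  simpa [wvec] using h J

theorem onWords_injective {n : ℕ} {φ ψ : Cochain K n}
    (h : ∀ I : List (ZMod 2), I.length = n → onWords φ I = onWords ψ I) : φ = ψ := by
  refine cochain_ext fun J => ?_
  have h1 := h (List.ofFn J) (by simp)
  rw [onWords_ofFn, onWords_ofFn] at h1
  have h2 := congrArg (fun x => parityW K (sgn K (∑ t, J t) • x)) h1
  simpa [smul_smul, sgn_mul_self, parityW_parityW] using h2

/-- The cochain whose twisted values `onWords` at the words of length `n` are given by `F`. -/
def ofWords (n : ℕ) (F : List (ZMod 2) → W K) : Cochain K n :=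
  ∑ J : Fin n → ZMod 2, ∑ i,
    (sgn K (∑ t, J t) * sgn K i * F (List.ofFn J) i) • phi K J i

theorem onWords_ofWords {n : ℕ} (F : List (ZMod 2) → W K) (I : List (ZMod 2))
    (hI : I.length = n) : onWords (ofWords n F) I = F I := by
  obtain ⟨J, rfl⟩ := exists_ofFn_eq hI
  rw [onWords_ofFn]
  have h : (ofWords n F fun t => wvec K (J t)) =
      ∑ i, (sgn K (∑ t, J t) * sgn K i * F (List.ofFn J) i) • wvec K i := by
    simp only [ofWords, sum_apply, smul_apply, phi_apply_wvec]
    rw [Finset.sum_eq_single J]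
    · simp
    · intro J' _ hJ
      simp [hJ]
    · simp
  rw [h]
  funext b
  have h1 := sgn_mul_self (K := K) (∑ t, J t)
  have h2 := sgn_mul_self (K := K) b
  simp only [Pi.smul_apply, parityW_apply, Finset.sum_apply, wvec, smul_eq_mul]
  rw [Finset.sum_eq_single b (by intro c _ hc; simp [hc.symm]) (by simp)]
  simp only [Pi.single_eq_same, mul_one]
  linear_combination sgn K b * sgn K b * F (List.ofFn J) b * h1 + F (List.ofFn J) b * h2

theorem hom_apply_wvec {n : ℕ} (p : ZMod 2) (φ : Cochain K n) (J : Fin n → ZMod 2) :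
    (hom p φ fun t => wvec K (J t)) = gr K (p + ∑ t, J t) (φ fun t => wvec K (J t)) := by
  change (∑ J' : Fin n → ZMod 2, (gr K (p + ∑ t, J' t)).compMultilinearMap
    (φ.compLinearMap fun t => gr K (J' t))) (fun t => wvec K (J t)) = _
  rw [sum_apply, Finset.sum_eq_single J]
  · have : ∀ t, gr K (J t) (wvec K (J t)) = wvec K (J t) := fun t => by simp [gr, wvec]
    simp [this]
  · intro J' _ hJ
    obtain ⟨t, ht⟩ := Function.ne_iff.1 hJ
    have h0 : gr K (J' t) (wvec K (J t)) = 0 := by simp [gr, wvec, ht]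
    simp only [LinearMap.compMultilinearMap_apply, MultilinearMap.compLinearMap_apply]
    rw [φ.map_coord_zero t h0, map_zero]
  · simp

theorem gr_apply (a b : ZMod 2) (x : W K) : gr K a x b = if b = a then x b else 0 := by
  by_cases h : b = a
  · subst h
    simp [gr]
  · simp [gr, h]

theorem ofStruct_apply (m : ZMod 2 → ZMod 2 → K) (v : Fin 2 → W K) (b : ZMod 2) :
    ofStruct m v b = ∑ a, m a (a + b + 1) * (v 0 a * v 1 (a + b + 1)) := by
  simp only [ofStruct, sum_apply, smul_apply, phi, wvec]
  simp only [sum_zmod_two]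
  rcases zmod_two_cases b with rfl | rfl <;> simp [CharTwo.add_self_eq_zero]

theorem ofStruct_apply_wvec (m : ZMod 2 → ZMod 2 → K) (v : Fin 2 → ZMod 2) :
    (ofStruct m fun t => wvec K (v t)) = m (v 0) (v 1) • wvec K (v 0 + v 1 + 1) := by
  funext b
  rw [ofStruct_apply, sum_zmod_two]
  rcases zmod_two_cases b with rfl | rfl <;> rcases zmod_two_cases (v 0) with h | h <;>
    rcases zmod_two_cases (v 1) with h' | h' <;>
    simp [wvec, h, h', CharTwo.add_self_eq_zero]

theorem hom_ofStruct (m : ZMod 2 → ZMod 2 → K) (p : ZMod 2) :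
    hom p (ofStruct m) = if p = 1 then ofStruct m else 0 := by
  refine cochain_ext fun J => ?_
  rw [hom_apply_wvec, ofStruct_apply_wvec]
  funext b
  have : b = p + (J 0 + J 1) ∧ b = J 0 + J 1 + 1 → p = 1 := by
    rintro ⟨h1, h2⟩
    linear_combination h2 - h1
  by_cases hp : p = 1
  · subst hp
    rw [if_pos rfl, ofStruct_apply_wvec, gr_apply]
    simp only [Fin.sum_univ_two, wvec]
    by_cases hb : b = 1 + (J 0 + J 1)
    · simp [hb]
    · rw [if_neg hb, Pi.smul_apply, Pi.single_eq_of_ne, smul_zero]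
      rwa [add_comm 1] at hb
  · rw [if_neg hp, gr_apply]
    simp only [Fin.sum_univ_two, wvec]
    split_ifs with hb
    · rw [Pi.smul_apply, Pi.single_eq_of_ne, smul_zero]
      · rfl
      · exact fun h => hp (this ⟨hb, h⟩)
    · rfl

theorem koszul_wvec (q a : ZMod 2) : koszul K q (wvec K a) = sgn K (q * a) • wvec K a := by
  funext b
  rcases zmod_two_cases q with rfl | rfl <;> rcases zmod_two_cases a with rfl | rfl <;>
    rcases zmod_two_cases b with rfl | rfl <;> simp [koszul, wvec, ZMod.val_one]

/-- The terms of `d ∘ ψ`. -/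
theorem circ_ofStruct_left_apply (m : ZMod 2 → ZMod 2 → K) {n : ℕ} (q : ZMod 2)
    (ψ : Cochain K n) (h : 2 + n = n + 1 + 1) (J : Fin (n + 1) → ZMod 2) :
    (circ h q (ofStruct m) ψ fun t => wvec K (J t)) =
      (ofStruct m ![ψ fun t => wvec K (J t.castSucc), wvec K (J (Fin.last n))]) +
      sgn K (q * J 0) • ofStruct m ![wvec K (J 0), ψ fun t => wvec K (J t.succ)] := by
  rw [circ, sum_apply, Fin.sum_univ_two, insertAt_apply, insertAt_apply]
  have h0 : insertArgs h 0 q ψ (fun t => wvec K (J t)) =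
      ![ψ fun t => wvec K (J t.castSucc), wvec K (J (Fin.last n))] := by
    funext j
    fin_cases j
    · simp [insertArgs]
      rfl
    · simp [insertArgs]
      congr 2
  have h1 : insertArgs h 1 q ψ (fun t => wvec K (J t)) = Function.update
      ![wvec K (J 0), ψ fun t => wvec K (J t.succ)] 0 (sgn K (q * J 0) • wvec K (J 0)) := by
    funext j
    fin_cases j
    · simp [insertArgs, koszul_wvec]
    · simp [insertArgs]
      congr 1
      funext t
      congr 2
      ext
      simp [add_comm]
  rw [h0, h1, MultilinearMap.map_update_smul]
  congr 3
  funext j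
  fin_cases j <;> simp

/-- The terms of `ψ ∘ d`. -/
theorem circ_ofStruct_right_apply (m : ZMod 2 → ZMod 2 → K) {n : ℕ}
    (ψ : Cochain K n) (h : n + 2 = n + 1 + 1) (J : Fin (n + 1) → ZMod 2) :
    (circ h 1 ψ (ofStruct m) fun t => wvec K (J t)) =
      ∑ i : Fin n, ((∏ j : Fin n, if j < i then sgn K (J j.castSucc) else 1) *
        m (J i.castSucc) (J i.succ)) • ψ fun t => wvec K (mergeAt J i t) := by
  simp only [circ, sum_apply, insertAt_apply]
  refine Finset.sum_congr rfl fun i _ => ?_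
  have h1 : insertArgs h i 1 (ofStruct m) (fun t => wvec K (J t)) = fun j =>
      ((if j < i then sgn K (J j.castSucc) else 1) *
        (if j = i then m (J i.castSucc) (J i.succ) else 1)) • wvec K (mergeAt J i j) := by
    funext j
    rcases lt_trichotomy j i with a | rfl | a
    · have a' : j.1 < i.1 := a
      simp only [insertArgs, a', dite_true, koszul_wvec, mergeAt, a, a.ne, if_true, if_false,
        one_mul, mul_one]
      rfl
    · simp only [insertArgs, lt_irrefl, dite_true, dite_false, mergeAt, if_true, if_false,
        one_mul]
      exact ofStruct_apply_wvec m fun t => J ⟨j.1 + t.1, by omega⟩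
    · have a' : ¬ j.1 < i.1 := not_lt.2 (le_of_lt a)
      have b' : ¬ j.1 = i.1 := fun e => a.ne (Fin.ext e.symm)
      simp only [insertArgs, a', b', dite_false, mergeAt, not_lt.2 a.le, a.ne', if_false,
        one_mul, one_smul]
      rfl
  rw [h1, MultilinearMap.map_smul_univ, Finset.prod_mul_distrib]
  simp

theorem gr_add_gr (a : ZMod 2) (x : W K) : gr K (0 + a) x + gr K (1 + a) x = x := by
  funext b
  rw [Pi.add_apply, gr_apply, gr_apply]
  rcases zmod_two_cases a with rfl | rfl <;> rcases zmod_two_cases b with rfl | rfl <;>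
    simp [CharTwo.add_self_eq_zero]

theorem gr_sub_gr (a : ZMod 2) (x : W K) :
    gr K (0 + a) x - gr K (1 + a) x = sgn K a • parityW K x := by
  funext b
  rw [Pi.sub_apply, gr_apply, gr_apply]
  rcases zmod_two_cases a with rfl | rfl <;> rcases zmod_two_cases b with rfl | rfl <;>
    simp [CharTwo.add_self_eq_zero]

theorem ofStruct_wvec_right (m : ZMod 2 → ZMod 2 → K) (x : W K) (w : ZMod 2) :
    ofStruct m ![x, wvec K w] = rhoW m w (parityW K x) := by
  funext b
  rw [ofStruct_apply, rhoW_apply, sum_zmod_two]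
  rcases zmod_two_cases w with rfl | rfl <;> rcases zmod_two_cases b with rfl | rfl <;>
    simp [CharTwo.add_self_eq_zero, wvec]

/-- The Koszul sign of `w` in `d (w, φ (⋯))` is what distinguishes `lamW` from the left
multiplication by `w`. -/
theorem ofStruct_wvec_left (m : ZMod 2 → ZMod 2 → K) (x : W K) (w a : ZMod 2) :
    ofStruct m ![wvec K w, gr K (0 + a) x] + sgn K w • ofStruct m ![wvec K w, gr K (1 + a) x] =
      sgn K ((w + 1) * a) • lamW m w (sgn K a • parityW K x) := by
  funext b
  rw [Pi.add_apply, Pi.smul_apply, ofStruct_apply, ofStruct_apply, Pi.smul_apply, lamW_apply,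
    sum_zmod_two, sum_zmod_two]
  rcases zmod_two_cases w with rfl | rfl <;> rcases zmod_two_cases b with rfl | rfl <;>
    rcases zmod_two_cases a with rfl | rfl <;>
    simp [CharTwo.add_self_eq_zero, wvec, gr_apply]

/-- On words, `D` is the differential `wordDiff` for the bimodule `W`. -/
theorem coboundary_apply_wvec (m : ZMod 2 → ZMod 2 → K) {n : ℕ} (φ : Cochain K n)
    (J : Fin (n + 1) → ZMod 2) :
    (coboundary (ofStruct m) n φ fun t => wvec K (J t)) =
      wordDiff m (lamW m) (rhoW m) (onWords φ) (List.ofFn J) := by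
  have hl : ∀ (q : ZMod 2) (ψ : Cochain K n), circ (Nat.add_comm 2 n) q (0 : Cochain K 2) ψ = 0 :=
    fun q ψ => by simpa using circ_smul_left (Nat.add_comm 2 n) q (0 : K) (0 : Cochain K 2) ψ
  have hr : ∀ (q : ZMod 2) (ψ : Cochain K n),
      circ (k := n) (l := 2) (m := n + 1) rfl q ψ (0 : Cochain K 2) = 0 := fun q ψ => by
    simpa using circ_smul_right (k := n) (l := 2) (m := n + 1) rfl q (0 : K) ψ (0 : Cochain K 2)
  have h0 : coboundary (ofStruct m) n φ = ∑ q : ZMod 2,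
      (circ (Nat.add_comm 2 n) q (ofStruct m) (hom q φ) -
        sgn K q • circ (k := n) (l := 2) (m := n + 1) rfl 1 (hom q φ) (ofStruct m)) := by
    change bracket _ _ _ = _
    rw [bracket, sum_zmod_two]
    simp only [hom_ofStruct, zero_ne_one, if_false, hl, hr, smul_zero, sub_zero,
      Finset.sum_const_zero, zero_add, if_true, ZMod.val_one, one_mul]
    rfl
  have hF : ∀ I : Fin n → ZMod 2, (hom 0 φ fun t => wvec K (I t)) -
      (hom 1 φ fun t => wvec K (I t)) = onWords φ (List.ofFn I) := fun I => by
    rw [hom_apply_wvec, hom_apply_wvec, gr_sub_gr, onWords_ofFn]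
  have hsum : (List.ofFn fun t : Fin n => J t.succ).sum = ∑ t : Fin n, J t.succ := List.sum_ofFn
  have hw : wordDiff m (lamW m) (rhoW m) (onWords φ) (List.ofFn J) =
      wordRight m (rhoW m) (onWords φ) (List.ofFn J) + sgn K ((J 0 + 1) * ∑ t : Fin n, J t.succ) •
        lamW m (J 0) (onWords φ (List.ofFn fun t : Fin n => J t.succ)) := by
    rw [List.ofFn_succ, wordDiff_cons, hsum]
  have hR : (ofStruct m ![hom 0 φ fun t => wvec K (J t.castSucc), wvec K (J (Fin.last n))]) +
      (ofStruct m ![hom 1 φ fun t => wvec K (J t.castSucc), wvec K (J (Fin.last n))]) =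
      sgn K (∑ t : Fin n, J t.castSucc) •
        rhoW m (J (Fin.last n)) (onWords φ (List.ofFn fun t : Fin n => J t.castSucc)) := by
    rw [ofStruct_wvec_right, ofStruct_wvec_right, ← map_add, ← map_add, hom_apply_wvec,
      hom_apply_wvec, gr_add_gr, onWords_ofFn, map_smul, smul_smul, sgn_mul_self, one_smul]
  have hL := ofStruct_wvec_left m (φ fun t => wvec K (J t.succ)) (J 0) (∑ t : Fin n, J t.succ)
  rw [← hom_apply_wvec, ← hom_apply_wvec, ← onWords_ofFn] at hL
  rw [h0, sum_zmod_two, add_apply, sub_apply, sub_apply, smul_apply, smul_apply,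
    circ_ofStruct_left_apply, circ_ofStruct_left_apply, circ_ofStruct_right_apply,
    circ_ofStruct_right_apply, hw, wordRight_ofFn, ← hR, ← hL]
  simp only [← hF, smul_sub, Finset.sum_sub_distrib, zero_mul, one_mul, sgn_zero, sgn_one]
  module

/-- The twist by the parity in `onWords` anticommutes with the differential. -/
theorem wordDiff_sgn_parityW (m : ZMod 2 → ZMod 2 → K) (F : List (ZMod 2) → W K)
    (I : List (ZMod 2)) :
    wordDiff m (lamW m) (rhoW m) (fun J => sgn K J.sum • parityW K (F J)) I =
      -(sgn K I.sum • parityW K (wordDiff m (lamW m) (rhoW m) F I)) := by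
  have h1 : ∀ w (x : W K), rhoW m w (parityW K x) = -(sgn K w • parityW K (rhoW m w x)) := by
    intro w x
    funext b
    simp only [rhoW_apply, parityW_apply, Pi.neg_apply, Pi.smul_apply, smul_eq_mul, sgn_add,
      sgn_one]
    ring
  have h2 : ∀ w (x : W K), lamW m w (parityW K x) = -(sgn K w • parityW K (lamW m w x)) := by
    intro w x
    funext b
    simp only [lamW_apply, parityW_apply, Pi.neg_apply, Pi.smul_apply, smul_eq_mul]
    rw [sgn_add, sgn_add, sgn_one]
    ring
  cases I with
  | nil => simp
  | cons w I =>
    rw [wordDiff_cons, wordDiff_cons, wordRight_sgn_map _ h1]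
    simp only [map_smul, map_add, h2, List.sum_cons, sgn_add]
    module

theorem onWords_coboundary (m : ZMod 2 → ZMod 2 → K) {n : ℕ} (φ : Cochain K n)
    (I : List (ZMod 2)) (hI : I.length = n + 1) :
    onWords (coboundary (ofStruct m) n φ) I =
      sgn K I.sum • parityW K (wordDiff m (lamW m) (rhoW m) (onWords φ) I) := by
  obtain ⟨J, rfl⟩ := exists_ofFn_eq hI
  rw [onWords_ofFn, coboundary_apply_wvec, List.sum_ofFn]

/-! ### Contracting homotopies -/

theorem isBimod_W {m : ZMod 2 → ZMod 2 → K} (hm : IsAssoc m) :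
    IsBimod m (lamW m) (rhoW m) where
  right w v x := by
    funext b
    have h := hm (w + v + b) w v
    simp only [rhoW_apply, Pi.smul_apply, smul_eq_mul]
    rcases zmod_two_cases w with rfl | rfl <;> rcases zmod_two_cases v with rfl | rfl <;>
      rcases zmod_two_cases b with rfl | rfl <;>
      simp only [CharTwo.add_self_eq_zero, add_zero, zero_add, sgn_zero, sgn_one] at h ⊢ <;>
      first
        | ring1
        | linear_combination x 0 * h
        | linear_combination x 1 * h
        | linear_combination -x 0 * h
        | linear_combination -x 1 * h
  left w v x := by
    funext b
    have h := hm w v (w + v + b)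
    simp only [lamW_apply, Pi.smul_apply, smul_eq_mul]
    rcases zmod_two_cases w with rfl | rfl <;> rcases zmod_two_cases v with rfl | rfl <;>
      rcases zmod_two_cases b with rfl | rfl <;>
      simp only [CharTwo.add_self_eq_zero, add_zero, zero_add, mul_zero, mul_one, sgn_zero,
        sgn_one] at h ⊢ <;>
      first
        | ring1
        | linear_combination x 0 * h
        | linear_combination x 1 * h
        | linear_combination -x 0 * h
        | linear_combination -x 1 * h
  comm w v x := by
    funext b
    have h := hm w (w + v + b) v
    simp only [rhoW_apply, lamW_apply, Pi.smul_apply, smul_eq_mul]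
    rcases zmod_two_cases w with rfl | rfl <;> rcases zmod_two_cases v with rfl | rfl <;>
      rcases zmod_two_cases b with rfl | rfl <;>
      simp only [CharTwo.add_self_eq_zero, add_zero, zero_add, mul_zero, mul_one, sgn_zero,
        sgn_one] at h ⊢ <;>
      first
        | ring1
        | linear_combination x 0 * h
        | linear_combination x 1 * h
        | linear_combination -x 0 * h
        | linear_combination -x 1 * h

/-- The function of words that vanishes unless the first letter is `e`, and then applies `G` to
the remaining letters. -/
def liftE (G : List (ZMod 2) → M) : List (ZMod 2) → M
  | [] => 0
  | w :: I => if w = 0 then G I else 0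

section

variable {m : ZMod 2 → ZMod 2 → K} {lam ρ : ZMod 2 → M →ₗ[K] M}

@[simp] theorem liftE_nil (G : List (ZMod 2) → M) : liftE G [] = 0 := rfl

@[simp] theorem liftE_zero_cons (G : List (ZMod 2) → M) (I : List (ZMod 2)) :
    liftE G (0 :: I) = G I := rfl

@[simp] theorem liftE_one_cons (G : List (ZMod 2) → M) (I : List (ZMod 2)) :
    liftE G (1 :: I) = 0 := rfl

/-- If `wordDiff F = 0` then `F` agrees, at the words that start with `f`, with the differential
of an explicit function. As `λ_f² = k λ_f` for the left action `λ_f` of `f`, the factor `2 λ_f - k`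
is an involution. -/
theorem wordDiff_homotopy (hk : m 1 1 * m 1 1 = 1)
    (hlam : ∀ x, lam 1 (lam 1 x) = m 1 1 • lam 1 x) (hcomm : ∀ w x, lam 1 (ρ w x) = ρ w (lam 1 x))
    {F : List (ZMod 2) → M} {I : List (ZMod 2)} (hF : wordDiff m lam ρ F (1 :: 1 :: I) = 0) :
    wordDiff m lam ρ (fun J => (2 : K) • lam 1 (F (1 :: J)) - m 1 1 • F (1 :: J)) (1 :: I) =
      F (1 :: I) := by
  have h1 := wordRight_map (m := m) (ρ := ρ) (ρ' := ρ)
    ((2 : K) • lam 1 - m 1 1 • LinearMap.id) (by simp [hcomm]) (fun J => F (1 :: J)) (1 :: I)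
  simp only [LinearMap.sub_apply, LinearMap.smul_apply, LinearMap.id_apply] at h1
  rw [wordDiff_cons, wordRight_cons_cons] at hF
  simp only [CharTwo.add_self_eq_zero, zero_add, zero_mul, sgn_zero, sgn_one, one_smul] at hF
  have h2 : wordRight m ρ (fun J => F (1 :: J)) (1 :: I) =
      lam 1 (F (1 :: I)) - m 1 1 • F (1 :: I) := by
    linear_combination (norm := module) -hF
  rw [wordDiff_cons, h1, h2]
  simp only [CharTwo.add_self_eq_zero, zero_mul, sgn_zero, one_smul, map_sub, map_smul, hlam]
  linear_combination (norm := module) hk • F (1 :: I)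

theorem wordDiff_liftE_zero_zero (G : List (ZMod 2) → M) (I : List (ZMod 2)) :
    wordDiff m lam ρ (liftE G) (0 :: 0 :: I) = wordDiff m lam ρ G (0 :: I) := by
  simp [wordDiff_cons, wordRight_cons_cons]

theorem wordDiff_liftE_zero_one (G : List (ZMod 2) → M) (I : List (ZMod 2)) :
    wordDiff m lam ρ (liftE G) (0 :: 1 :: I) =
      -(m 0 1 • G I) + wordRight m ρ G (1 :: I) := by
  simp [wordDiff_cons, wordRight_cons_cons, CharTwo.add_self_eq_zero]

theorem wordDiff_liftE_one_zero (G : List (ZMod 2) → M) (I : List (ZMod 2)) :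
    wordDiff m lam ρ (liftE G) (1 :: 0 :: I) = lam 1 (G I) - m 1 0 • G I := by
  simp [wordDiff_cons, wordRight_cons_cons, CharTwo.add_self_eq_zero, wordRight_zero]
  abel

theorem wordDiff_liftE_one_one (G : List (ZMod 2) → M) (I : List (ZMod 2)) :
    wordDiff m lam ρ (liftE G) (1 :: 1 :: I) = 0 := by
  simp [wordDiff_cons, wordRight_cons_cons, CharTwo.add_self_eq_zero, wordRight_zero]

theorem wordDiff_liftE_singleton (G : List (ZMod 2) → M) (w : ZMod 2) :
    wordDiff m lam ρ (liftE G) [w] = 0 := by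
  simp [wordDiff_cons]

/-- The differential of a function that vanishes at the words of the relevant length that start
with `f`. -/
theorem wordDiff_zero_cons_of_vanish {F : List (ZMod 2) → M} {v : ZMod 2} {I : List (ZMod 2)}
    (h : F (1 :: I) = 0) :
    wordDiff m lam ρ F (0 :: v :: I) = -(m 0 1 • (if v = 1 then F (0 :: I) else 0)) +
      wordRight m ρ (fun J => F (0 :: J)) (v :: I) +
      sgn K (v + I.sum) • lam 0 (F (v :: I)) := by
  rcases zmod_two_cases v with rfl | rfl <;>
    simp [wordDiff_cons, wordRight_cons_cons, h, CharTwo.add_self_eq_zero]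

theorem wordDiff_one_zero_cons_of_vanish {F : List (ZMod 2) → M} {I : List (ZMod 2)}
    (h : ∀ J : List (ZMod 2), J.length = I.length → F (1 :: J) = 0) :
    wordDiff m lam ρ F (1 :: 0 :: I) = lam 1 (F (0 :: I)) - m 1 0 • F (0 :: I) := by
  have h1 : wordRight m ρ (fun J => F (1 :: J)) (0 :: I) = 0 := by
    rw [wordRight_congr (F' := fun _ => 0) fun J hJ => h J (by simpa using hJ), wordRight_zero]
  rw [wordDiff_cons, wordRight_cons_cons, h1]
  simp [CharTwo.add_self_eq_zero]
  abel

/-- The normalization theorem for a bimodule on which `f` acts by a scalar from the left: up to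
coboundaries, a cocycle vanishes at all words that contain `f`. -/
theorem exists_wordDiff_eq_of_mem (hk : m 1 1 * m 1 1 = 1) (hc : m 1 0 = -m 0 1)
    (hck : m 1 0 * m 1 0 = m 1 1 * m 1 0) (hlam : ∀ x, lam 1 x = m 1 0 • x)
    (hDD : ∀ (F : List (ZMod 2) → M) I, wordDiff m lam ρ (wordDiff m lam ρ F) I = 0) :
    ∀ (n : ℕ) (F : List (ZMod 2) → M),
      (∀ I : List (ZMod 2), I.length = n + 1 → wordDiff m lam ρ F I = 0) →
      ∃ G, ∀ I : List (ZMod 2), I.length = n → 1 ∈ I → F I = wordDiff m lam ρ G I := by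
  intro n
  induction n with
  | zero =>
    intro F _
    refine ⟨F, fun I hI h1 => ?_⟩
    simp [List.length_eq_zero_iff.1 hI] at h1
  | succ n ih =>
    intro F hF
    set G1 : List (ZMod 2) → M := fun J => (2 : K) • lam 1 (F (1 :: J)) - m 1 1 • F (1 :: J)
      with hG1
    have h1 : ∀ I : List (ZMod 2), I.length = n → wordDiff m lam ρ G1 (1 :: I) = F (1 :: I) :=
      fun I hI => wordDiff_homotopy hk (fun x => by simp [hlam, smul_smul, hck])
        (fun w x => by simp [hlam]) (hF _ (by simp [hI]))
    set F1 : List (ZMod 2) → M := fun J => F J - wordDiff m lam ρ G1 J with hF1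
    have hF1d : ∀ I : List (ZMod 2), I.length = n + 1 + 1 → wordDiff m lam ρ F1 I = 0 := by
      intro I hI
      rw [hF1, wordDiff_sub, hF I hI, hDD, sub_zero]
    have hF1v : ∀ I : List (ZMod 2), I.length = n → F1 (1 :: I) = 0 := by
      intro I hI
      simp [hF1, h1 I hI]
    -- the cocycle condition for `F1 (e ⋯)` is the one for `F1` at the words that start with `e`
    obtain ⟨G', hG'⟩ := ih (fun J => F1 (0 :: J)) (by
      intro I hI
      cases I with
      | nil => rfl
      | cons v I =>
        have hI' : I.length = n := by simpa using hI
        have h2 := hF1d (0 :: v :: I) (by simp [hI'])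
        rw [wordDiff_zero_cons_of_vanish (hF1v I hI')] at h2
        rcases zmod_two_cases v with rfl | rfl
        · simpa [wordDiff_cons] using h2
        · rw [hF1v I hI'] at h2
          simp only [wordDiff_cons, CharTwo.add_self_eq_zero, zero_mul, sgn_zero, one_smul, hlam]
          simp only [if_true, map_zero, smul_zero, add_zero] at h2
          rw [hc, ← h2]
          module)
    refine ⟨fun J => G1 J + liftE G' J, fun I hI hmem => ?_⟩
    rw [wordDiff_add]
    cases I with
    | nil => simp at hI
    | cons w I =>
      have hI' : I.length = n := by simpa using hI
      rcases zmod_two_cases w with rfl | rfl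
      · have hmem' : 1 ∈ I := by simpa using hmem
        have h3 := hG' I hI' hmem'
        have h4 : wordDiff m lam ρ (liftE G') (0 :: I) = wordDiff m lam ρ G' I := by
          cases I with
          | nil => simp at hmem'
          | cons v I =>
            rcases zmod_two_cases v with rfl | rfl
            · exact wordDiff_liftE_zero_zero _ _
            · rw [wordDiff_liftE_zero_one, wordDiff_cons, hlam, hc]
              simp only [CharTwo.add_self_eq_zero, zero_mul, sgn_zero, one_smul]
              module
        rw [h4, ← h3]
        simp [hF1]
      · have h4 : wordDiff m lam ρ (liftE G') (1 :: I) = 0 := by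
          cases I with
          | nil => exact wordDiff_liftE_singleton _ _
          | cons v I =>
            rcases zmod_two_cases v with rfl | rfl
            · rw [wordDiff_liftE_one_zero, hlam, sub_self]
            · exact wordDiff_liftE_one_one _ _
        rw [h1 I hI', h4, add_zero]

/-- Up to coboundaries, a cocycle vanishes at the words that start with `f`, and its values at the
other words are eigenvectors of the left action of `f`, with eigenvalue the one of `f` on `e`. -/
theorem exists_vanish_one_cons (hk : m 1 1 * m 1 1 = 1)
    (hlam : ∀ x, lam 1 (lam 1 x) = m 1 1 • lam 1 x) (hcomm : ∀ w x, lam 1 (ρ w x) = ρ w (lam 1 x))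
    (hDD : ∀ (F : List (ZMod 2) → M) I, wordDiff m lam ρ (wordDiff m lam ρ F) I = 0)
    {n : ℕ} {F : List (ZMod 2) → M}
    (hF : ∀ I : List (ZMod 2), I.length = n + 2 → wordDiff m lam ρ F I = 0) :
    ∃ G F1 : List (ZMod 2) → M, (∀ I, F I = F1 I + wordDiff m lam ρ G I) ∧
      (∀ I : List (ZMod 2), I.length = n + 2 → wordDiff m lam ρ F1 I = 0) ∧
      (∀ I : List (ZMod 2), I.length = n → F1 (1 :: I) = 0) ∧
      ∀ I : List (ZMod 2), I.length = n → lam 1 (F1 (0 :: I)) = m 1 0 • F1 (0 :: I) := by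
  set G1 : List (ZMod 2) → M := fun J => (2 : K) • lam 1 (F (1 :: J)) - m 1 1 • F (1 :: J)
    with hG1
  have h1 : ∀ I : List (ZMod 2), I.length = n → wordDiff m lam ρ G1 (1 :: I) = F (1 :: I) :=
    fun I hI => wordDiff_homotopy hk hlam hcomm (hF _ (by simp [hI]))
  have hd : ∀ I : List (ZMod 2), I.length = n + 2 →
      wordDiff m lam ρ (fun J => F J - wordDiff m lam ρ G1 J) I = 0 := by
    intro I hI
    rw [wordDiff_sub, hF I hI, hDD, sub_zero]
  have hv : ∀ I : List (ZMod 2), I.length = n → F (1 :: I) - wordDiff m lam ρ G1 (1 :: I) = 0 := by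
    intro I hI
    rw [h1 I hI, sub_self]
  refine ⟨G1, fun J => F J - wordDiff m lam ρ G1 J, fun I => by simp, hd, hv, fun I hI => ?_⟩
  have h2 := hd (1 :: 0 :: I) (by simp [hI])
  rw [wordDiff_one_zero_cons_of_vanish fun J hJ => hv J (hJ.trans hI)] at h2
  exact sub_eq_zero.1 h2

/-- The normalization theorem when `e` is annihilated by `f` on both sides and acts as zero on `M`
from the left; `π` projects to the kernel of the left action of `f`. -/
theorem exists_wordDiff_eq_of_mem_of_annihilated (hk : m 1 1 * m 1 1 = 1) (hc : m 0 1 = 0)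
    (hc' : m 1 0 = 0) (hm : IsAssoc m) (hM : IsBimod m lam ρ) (hlam0 : ∀ x, lam 0 x = 0)
    (hlam : ∀ x, lam 1 (lam 1 x) = m 1 1 • lam 1 x) (π : M →ₗ[K] M)
    (hπ : ∀ w x, π (ρ w x) = ρ w (π x)) (hπl : ∀ x, lam 1 (π x) = 0)
    (hπk : ∀ x, lam 1 x = 0 → π x = x) {n : ℕ} {F : List (ZMod 2) → M}
    (hF : ∀ I : List (ZMod 2), I.length = n + 2 → wordDiff m lam ρ F I = 0) :
    ∃ G, ∀ I : List (ZMod 2), I.length = n + 1 → 1 ∈ I → F I = wordDiff m lam ρ G I := by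
  obtain ⟨G1, F1, h1, hd, hv, he⟩ := exists_vanish_one_cons hk hlam
    (fun w x => by simpa [CharTwo.add_self_eq_zero] using (hM.comm 1 w x).symm)
    (wordDiff_wordDiff hm hM) hF
  obtain ⟨G', hG'⟩ := exists_wordDiff_eq_of_mem (m := m) (lam := 0) (ρ := ρ) hk (by simp [hc, hc'])
    (by simp [hc']) (by simp [hc'])
    (wordDiff_wordDiff hm ⟨hM.right, by simp, by simp⟩) n (fun J => F1 (0 :: J)) (by
      intro I hI
      cases I with
      | nil => rfl
      | cons v I =>
        have hI' : I.length = n := by simpa using hI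
        have h2 := hd (0 :: v :: I) (by simp [hI'])
        rw [wordDiff_zero_cons_of_vanish (hv I hI')] at h2
        simpa [wordDiff_cons, hc, hlam0] using h2)
  refine ⟨fun J => G1 J + liftE (fun J => π (G' J)) J, fun I hI hmem => ?_⟩
  rw [wordDiff_add, h1, add_comm, add_right_inj]
  cases I with
  | nil => simp at hI
  | cons w I =>
    have hI' : I.length = n := by simpa using hI
    cases I with
    | nil =>
      obtain rfl : w = 1 := by simpa [eq_comm] using hmem
      rw [hv _ hI', wordDiff_liftE_singleton]
    | cons v I =>
      rcases zmod_two_cases w with rfl | rfl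
      · have h3 := hG' (v :: I) hI' (by simpa using hmem)
        have h4 := wordRight_map (m := m) (ρ := ρ) (ρ' := ρ) π hπ G' (v :: I)
        simp only [wordDiff_cons, LinearMap.zero_apply, Pi.zero_apply, smul_zero, add_zero] at h3
        rw [← h3, hπk _ (by rw [he _ hI', hc', zero_smul])] at h4
        rcases zmod_two_cases v with rfl | rfl
        · rw [wordDiff_liftE_zero_zero, wordDiff_cons, h4, hlam0, smul_zero, add_zero]
        · rw [wordDiff_liftE_zero_one, h4, hc, zero_smul, neg_zero, zero_add]
      · rw [hv _ hI']
        rcases zmod_two_cases v with rfl | rfl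
        · rw [wordDiff_liftE_one_zero, hπl, hc', zero_smul, sub_zero]
        · rw [wordDiff_liftE_one_one]

/-- If the left and right eigenvalues of `f` on `e` differ, then every cocycle in degree at least
two is a coboundary: up to coboundaries only the values at words `e e ⋯` remain, and these vanish
because `f` can be moved from one `e` to the other. -/
theorem exists_wordDiff_eq_of_ne (hk : m 1 1 * m 1 1 = 1) (hne : m 0 1 + m 1 0 ≠ 0)
    (hck : m 0 1 * m 0 1 = -(m 1 1 * m 0 1)) (hm : IsAssoc m) (hM : IsBimod m lam ρ)
    (hlam : ∀ x, lam 1 (lam 1 x) = m 1 1 • lam 1 x) {n : ℕ} {F : List (ZMod 2) → M}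
    (hF : ∀ I : List (ZMod 2), I.length = n + 3 → wordDiff m lam ρ F I = 0) :
    ∃ G, ∀ I : List (ZMod 2), I.length = n + 2 → F I = wordDiff m lam ρ G I := by
  obtain ⟨G1, F1, h1, hd, hv, he⟩ := exists_vanish_one_cons hk hlam
    (fun w x => by simpa [CharTwo.add_self_eq_zero] using (hM.comm 1 w x).symm)
    (wordDiff_wordDiff hm hM) hF
  -- the factor `2 λ_f - k` for the left action of `f` by the scalar `-c`
  set a : K := -(2 * m 0 1 + m 1 1) with ha
  have haa : a * a = 1 := by linear_combination 4 * hck + hk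
  set G2 : List (ZMod 2) → M := liftE fun J => a • F1 (0 :: 1 :: J) with hG2
  have h2 : ∀ I : List (ZMod 2), I.length = n →
      wordDiff m lam ρ G2 (0 :: 1 :: I) = F1 (0 :: 1 :: I) := by
    intro I hI
    have h3 := hd (0 :: 1 :: 1 :: I) (by simp [hI])
    rw [wordDiff_zero_cons_of_vanish (hv _ (by simp [hI])), wordRight_cons_cons,
      hv _ (by simp [hI])] at h3
    simp only [if_true, map_zero, smul_zero, add_zero, sgn_one, CharTwo.add_self_eq_zero,
      zero_add] at h3
    rw [hG2, wordDiff_liftE_zero_one, wordRight_smul]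
    linear_combination (norm := module) haa • F1 (0 :: 1 :: I) - a • h3
  have h2' : ∀ I : List (ZMod 2), I.length = n + 1 → wordDiff m lam ρ G2 (1 :: I) = 0 := by
    intro I hI
    cases I with
    | nil => simp at hI
    | cons v I =>
      rcases zmod_two_cases v with rfl | rfl
      · rw [hG2, wordDiff_liftE_one_zero, map_smul, he _ (by simpa using hI), smul_comm, sub_self]
      · exact wordDiff_liftE_one_one _ _
  set F2 : List (ZMod 2) → M := fun J => F1 J - wordDiff m lam ρ G2 J with hF2
  have hd2 : ∀ I : List (ZMod 2), I.length = n + 3 → wordDiff m lam ρ F2 I = 0 := by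
    intro I hI
    rw [hF2, wordDiff_sub, hd I hI, wordDiff_wordDiff hm hM, sub_zero]
  have hv2 : ∀ I : List (ZMod 2), I.length = n + 1 → F2 (1 :: I) = 0 := by
    intro I hI
    simp [hF2, hv I hI, h2' I hI]
  have hv2' : ∀ I : List (ZMod 2), I.length = n → F2 (0 :: 1 :: I) = 0 := by
    intro I hI
    simp [hF2, h2 I hI]
  have hv3 : ∀ I : List (ZMod 2), I.length = n → F2 (0 :: 0 :: I) = 0 := by
    intro I hI
    -- at `e f e ⋯` only the terms with the products `e f` and `f e` are left
    have h3 := hd2 (0 :: 1 :: 0 :: I) (by simp [hI])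
    rw [wordDiff_zero_cons_of_vanish (hv2 _ (by simp [hI])), wordRight_cons_cons,
      hv2 _ (by simp [hI]), wordRight_congr (F' := fun _ => 0)
        fun J hJ => hv2' J (by simp at hJ; omega), wordRight_zero] at h3
    simp only [if_true, map_zero, smul_zero, add_zero, CharTwo.add_self_eq_zero] at h3
    have h4 : (m 0 1 + m 1 0) • F2 (0 :: 0 :: I) = 0 := by
      linear_combination (norm := module) -h3
    exact (smul_eq_zero.1 h4).resolve_left hne
  refine ⟨fun J => G1 J + G2 J, fun I hI => ?_⟩
  have h5 : F2 I = 0 := by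
    match I, hI with
    | w :: v :: I, hI =>
      have hI' : I.length = n := by simpa using hI
      rcases zmod_two_cases w with rfl | rfl
      · rcases zmod_two_cases v with rfl | rfl
        · exact hv3 I hI'
        · exact hv2' I hI'
      · exact hv2 _ (by simp [hI'])
  rw [wordDiff_add, h1, sub_eq_zero.1 h5, add_comm]

/-! ### Normalized functions of words -/

/-- The function of words that takes the value `x` at the words `e ⋯ e` and vanishes at all other
words. -/
def normalized (x : M) (I : List (ZMod 2)) : M := if 1 ∈ I then 0 else x

theorem normalized_one_cons (x : M) (I : List (ZMod 2)) : normalized x (1 :: I) = 0 := by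
  simp [normalized]

theorem normalized_zero_cons (x : M) (I : List (ZMod 2)) :
    normalized x (0 :: I) = normalized x I := by
  simp [normalized]

theorem wordDiff_normalized (hc : m 1 0 = -m 0 1) {x : M} (hl : lam 1 x = m 1 0 • x)
    (hr : ρ 1 x = -(m 1 0 • x)) (w : ZMod 2) (I : List (ZMod 2)) :
    wordDiff m lam ρ (normalized x) (w :: I) = normalized (ρ 0 x + lam 0 x) (w :: I) := by
  have h1 : ∀ I, wordRight m ρ (normalized x) (1 :: I) = -(m 1 0 • normalized x I) := by
    intro I
    cases I with
    | nil => simpa [normalized] using hr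
    | cons v I =>
      rw [wordRight_cons_cons]
      simp only [normalized_one_cons, wordRight_zero]
      rcases zmod_two_cases v with rfl | rfl <;>
        simp [normalized_one_cons, normalized_zero_cons, CharTwo.add_self_eq_zero]
  have h0 : ∀ I, wordRight m ρ (normalized x) (0 :: I) = normalized (ρ 0 x) I := by
    intro I
    induction I with
    | nil => simp [normalized]
    | cons v I ih =>
      rw [wordRight_cons_cons]
      simp only [normalized_zero_cons]
      rcases zmod_two_cases v with rfl | rfl
      · simpa [normalized_one_cons, normalized_zero_cons] using ih
      · change _ + sgn K 0 • wordRight m ρ (normalized x) (1 :: I) = _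
        rw [h1]
        simp [normalized_one_cons, normalized_zero_cons, CharTwo.add_self_eq_zero, hc]
  have hsum : ∀ I : List (ZMod 2), 1 ∉ I → I.sum = 0 := fun I hI =>
    List.sum_eq_zero fun a ha => (zmod_two_cases a).resolve_right fun h => hI (h ▸ ha)
  rw [wordDiff_cons]
  rcases zmod_two_cases w with rfl | rfl
  · rw [h0, normalized_zero_cons]
    by_cases hI : 1 ∈ I
    · simp [normalized, hI]
    · simp [normalized, hI, hsum I hI]
  · rw [h1, normalized_one_cons]
    by_cases hI : 1 ∈ I
    · simp [normalized, hI]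
    · simp [normalized, hI, hl, CharTwo.add_self_eq_zero]

/-- When `e` squares to zero, the products inside words do not contribute at `e ⋯ e`. -/
theorem wordDiff_replicate_zero (ht : m 0 0 = 0) (F : List (ZMod 2) → M) (n : ℕ) :
    wordDiff m lam ρ F (List.replicate (n + 1) 0) =
      ρ 0 (F (List.replicate n 0)) + lam 0 (F (List.replicate n 0)) := by
  have h : wordRight m ρ F (List.replicate (n + 1) 0) = ρ 0 (F (List.replicate n 0)) := by
    induction n generalizing F with
    | zero => simp
    | succ n ih =>
      have := ih fun J => F (0 :: J)
      rw [List.replicate_succ] at this ⊢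
      rw [List.replicate_succ, wordRight_cons_cons, this, ht]
      simp
  rw [List.replicate_succ, wordDiff_cons, ← List.replicate_succ, h]
  simp
end

/-! ### From words back to cohomology -/

theorem zmod_two_fun_ext {A : Type*} {x y : ZMod 2 → A} (h0 : x 0 = y 0) (h1 : x 1 = y 1) :
    x = y := by
  funext b
  rcases zmod_two_cases b with rfl | rfl
  · exact h0
  · exact h1

theorem lamW_wvec (m : ZMod 2 → ZMod 2 → K) (w a : ZMod 2) :
    lamW m w (wvec K a) = (sgn K ((w + 1) * a) * m w a) • wvec K (w + a + 1) := by
  funext b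
  rw [lamW_apply]
  rcases zmod_two_cases w with rfl | rfl <;> rcases zmod_two_cases a with rfl | rfl <;>
    rcases zmod_two_cases b with rfl | rfl <;> simp [CharTwo.add_self_eq_zero, wvec]

theorem rhoW_wvec (m : ZMod 2 → ZMod 2 → K) (w a : ZMod 2) :
    rhoW m w (wvec K a) = (sgn K a * m a w) • wvec K (a + w + 1) := by
  funext b
  rw [rhoW_apply]
  rcases zmod_two_cases w with rfl | rfl <;> rcases zmod_two_cases a with rfl | rfl <;>
    rcases zmod_two_cases b with rfl | rfl <;> simp [CharTwo.add_self_eq_zero, wvec]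

theorem eq_wvec_add_wvec (x : W K) : x = x 0 • wvec K 0 + x 1 • wvec K 1 := by
  funext b
  rcases zmod_two_cases b with rfl | rfl <;> simp [wvec]

theorem onWords_add {n : ℕ} (φ ψ : Cochain K n) (I : List (ZMod 2)) :
    onWords (φ + ψ) I = onWords φ I + onWords ψ I := by
  simp [onWords]

theorem onWords_smul {n : ℕ} (a : K) (φ : Cochain K n) (I : List (ZMod 2)) :
    onWords (a • φ) I = a • onWords φ I := by
  simp [onWords, smul_comm a]

theorem onWords_sub {n : ℕ} (φ ψ : Cochain K n) (I : List (ZMod 2)) :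
    onWords (φ - ψ) I = onWords φ I - onWords ψ I := by
  rw [sub_eq_add_neg, ← neg_one_smul K ψ, onWords_add, onWords_smul, neg_one_smul, sub_eq_add_neg]

theorem eq_replicate_of_one_not_mem {n : ℕ} {I : List (ZMod 2)} (hI : I.length = n) (h : 1 ∉ I) :
    I = List.replicate n 0 :=
  List.eq_replicate_iff.2 ⟨hI, fun a ha => (zmod_two_cases a).resolve_right fun e => h (e ▸ ha)⟩

theorem one_not_mem_replicate (n : ℕ) : (1 : ZMod 2) ∉ List.replicate n 0 := fun h =>
  one_ne_zero (List.eq_of_mem_replicate h)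

theorem onWords_phi_ePow {n : ℕ} (i : ZMod 2) (I : List (ZMod 2)) (hI : I.length = n) :
    onWords (phi K (ePow n) i) I = normalized (sgn K i • wvec K i) I := by
  obtain ⟨J, rfl⟩ := exists_ofFn_eq hI
  rw [onWords_ofFn, phi_apply_wvec]
  by_cases h : ePow n = J
  · subst h
    have h1 : (1 : ZMod 2) ∉ List.ofFn (ePow n) := by
      simp [List.mem_ofFn, ePow]
    funext b
    simp only [normalized, h1, if_true, if_false, Pi.smul_apply, parityW_apply, smul_eq_mul]
    simp only [ePow, Finset.sum_const_zero, sgn_zero, one_mul, wvec]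
    by_cases hb : b = i
    · rw [hb]
    · rw [Pi.single_eq_of_ne hb]
      simp
  · have h1 : (1 : ZMod 2) ∈ List.ofFn J := by
      obtain ⟨t, ht⟩ := Function.ne_iff.1 h
      exact List.mem_ofFn.2 ⟨t, (zmod_two_cases _).resolve_left fun e => ht e.symm⟩
    simp [h, normalized, h1]

theorem mem_cocycles_iff {m : ZMod 2 → ZMod 2 → K} {n : ℕ} {φ : Cochain K n} :
    φ ∈ cocycles (ofStruct m) n ↔ ∀ I : List (ZMod 2), I.length = n + 1 →
      wordDiff m (lamW m) (rhoW m) (onWords φ) I = 0 := by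
  rw [cocycles, LinearMap.mem_ker]
  constructor
  · intro h I hI
    obtain ⟨J, rfl⟩ := exists_ofFn_eq hI
    rw [← coboundary_apply_wvec, h]
    rfl
  · intro h
    refine cochain_ext fun J => ?_
    rw [coboundary_apply_wvec, h _ (by simp)]
    rfl

theorem coboundary_comp_coboundary {m : ZMod 2 → ZMod 2 → K} (hm : IsAssoc m) (n : ℕ) :
    coboundary (ofStruct m) (n + 1) ∘ₗ coboundary (ofStruct m) n = 0 := by
  refine LinearMap.ext fun φ => ?_
  change coboundary (ofStruct m) n φ ∈ cocycles (ofStruct m) (n + 1)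
  rw [mem_cocycles_iff]
  intro I hI
  have h0 := wordDiff_sgn_parityW m (wordDiff m (lamW m) (rhoW m) (onWords φ)) I
  rw [wordDiff_wordDiff hm (isBimod_W hm), map_zero, smul_zero, neg_zero] at h0
  rw [← h0]
  exact wordDiff_congr fun J hJ => onWords_coboundary m φ J (by omega)

theorem coboundaries_le_cocycles {m : ZMod 2 → ZMod 2 → K} (hm : IsAssoc m) (n : ℕ) :
    coboundaries (ofStruct m) n ≤ cocycles (ofStruct m) n := by
  cases n with
  | zero => exact bot_le
  | succ n =>
    rintro _ ⟨φ, rfl⟩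
    exact LinearMap.congr_fun (coboundary_comp_coboundary hm n) φ

theorem isCodifferential_ofStruct {m : ZMod 2 → ZMod 2 → K} (hm : IsAssoc m) :
    IsCodifferential (ofStruct m) := by
  refine ⟨by rw [hom_ofStruct, if_pos rfl], ?_⟩
  change ofStruct m ∈ cocycles (ofStruct m) 2
  have h : ∀ a b, onWords (ofStruct m) [a, b] = -(m a b • wvec K (a + b + 1)) := by
    intro a b
    have h1 := onWords_ofFn (ofStruct m) ![a, b]
    rw [ofStruct_apply_wvec] at h1
    simp only [List.ofFn_succ, List.ofFn_zero, Fin.sum_univ_two] at h1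
    refine h1.trans ?_
    rcases zmod_two_cases a with rfl | rfl <;> rcases zmod_two_cases b with rfl | rfl <;>
      funext i <;> rcases zmod_two_cases i with rfl | rfl <;>
      simp [wvec, CharTwo.add_self_eq_zero]
  rw [mem_cocycles_iff]
  intro I hI
  match I, hI with
  | [a, b, c], _ =>
    have h2 := hm a b c
    simp only [wordDiff_cons, wordRight_cons_cons, wordRight_singleton, h, map_neg, map_smul,
      lamW_wvec, rhoW_wvec, List.sum_cons, List.sum_nil, add_zero]
    rcases zmod_two_cases a with rfl | rfl <;> rcases zmod_two_cases b with rfl | rfl <;>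
      rcases zmod_two_cases c with rfl | rfl <;>
      simp only [CharTwo.add_self_eq_zero, add_zero, zero_add, mul_one, mul_zero, sgn_zero,
        sgn_one] at h2 ⊢ <;>
      first
        | linear_combination (norm := module) (2 : K) • h2 • wvec K 0
        | linear_combination (norm := module) (2 : K) • h2 • wvec K 1

/-- Differentials of functions of words are coboundaries. -/
theorem exists_mem_coboundaries (m : ZMod 2 → ZMod 2 → K) (n : ℕ) (G : List (ZMod 2) → W K) :
    ∃ χ ∈ coboundaries (ofStruct m) (n + 1), ∀ I : List (ZMod 2), I.length = n + 1 →
      onWords χ I = wordDiff m (lamW m) (rhoW m) G I := by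
  refine ⟨_, ⟨ofWords n fun J => -(sgn K J.sum • parityW K (G J)), rfl⟩, fun I hI => ?_⟩
  have h1 : wordDiff m (lamW m) (rhoW m)
      (onWords (ofWords n fun J => -(sgn K J.sum • parityW K (G J)))) I =
      wordDiff m (lamW m) (rhoW m) (fun J => (-1 : K) • sgn K J.sum • parityW K (G J)) I :=
    wordDiff_congr fun J hJ => by rw [onWords_ofWords _ _ (by omega), neg_one_smul]
  rw [onWords_coboundary m _ I hI, h1, wordDiff_smul, wordDiff_sgn_parityW, neg_one_smul, neg_neg,
    map_smul, smul_smul, sgn_mul_self, one_smul, parityW_parityW]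

/-- Two cochains with the same values at the words that contain `f` differ by a combination of
the cochains `φ^{e^n}_i`. -/
theorem eq_add_of_forall_mem {n : ℕ} {φ χ : Cochain K n}
    (h : ∀ I : List (ZMod 2), I.length = n → 1 ∈ I → onWords φ I = onWords χ I) :
    φ = χ + (onWords (φ - χ) (List.replicate n 0) 0 • phi K (ePow n) 0 +
      (-onWords (φ - χ) (List.replicate n 0) 1) • phi K (ePow n) 1) := by
  refine onWords_injective fun I hI => ?_
  rw [onWords_add, onWords_add, onWords_smul, onWords_smul, onWords_phi_ePow _ _ hI,
    onWords_phi_ePow _ _ hI]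
  by_cases h1 : 1 ∈ I
  · simp [h I hI h1, normalized, h1]
  · rw [eq_replicate_of_one_not_mem hI h1, onWords_sub]
    have h2 := eq_wvec_add_wvec (onWords φ (List.replicate n 0) - onWords χ (List.replicate n 0))
    simp only [normalized, one_not_mem_replicate, if_false, sgn_zero, sgn_one]
    linear_combination (norm := module) h2

theorem onWords_eq_normalized {n : ℕ} {φ : Cochain K n}
    (h : ∀ I : List (ZMod 2), I.length = n → 1 ∈ I → onWords φ I = 0)
    {I : List (ZMod 2)} (hI : I.length = n) :
    onWords φ I = normalized (onWords φ (List.replicate n 0)) I := by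
  by_cases h1 : 1 ∈ I
  · simp [h I hI h1, normalized, h1]
  · rw [eq_replicate_of_one_not_mem hI h1]
    simp [normalized]

theorem exists_basis_quotient {V ι : Type*} [AddCommGroup V] [Module K V] [Fintype ι]
    (p : Submodule K V) (v : ι → V) (hspan : ∀ x, ∃ c : ι → K, x - ∑ i, c i • v i ∈ p)
    (hind : ∀ c : ι → K, ∑ i, c i • v i ∈ p → c = 0) :
    ∃ b : Module.Basis ι K (V ⧸ p), ∀ i, b i = Submodule.Quotient.mk (v i) := by
  have hli : LinearIndependent K fun i => p.mkQ (v i) := by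
    rw [Fintype.linearIndependent_iff]
    intro c hc
    simp only [← map_smul, ← map_sum] at hc
    exact congrFun (hind c ((Submodule.Quotient.mk_eq_zero p).1 hc))
  have hsp : ⊤ ≤ Submodule.span K (Set.range fun i => p.mkQ (v i)) := by
    rintro x -
    obtain ⟨x, rfl⟩ := p.mkQ_surjective x
    obtain ⟨c, hc⟩ := hspan x
    refine (Submodule.mem_span_range_iff_exists_fun K).2 ⟨c, ?_⟩
    simp only [← map_smul, ← map_sum]
    exact ((Submodule.Quotient.eq p).2 hc).symm
  exact ⟨Module.Basis.mk hli hsp, fun i => by simp⟩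

/-- A family of cocycles that is independent modulo coboundaries and spans the cocycles modulo
coboundaries gives a basis of the cohomology. -/
theorem classesFormBasis_of {d : Cochain K 2} {n : ℕ} {ι : Type*} [Fintype ι]
    {v : ι → Cochain K n} (hv : ∀ i, v i ∈ cocycles d n)
    (hspan : ∀ φ ∈ cocycles d n, ∃ c : ι → K, φ - ∑ i, c i • v i ∈ coboundaries d n)
    (hind : ∀ c : ι → K, ∑ i, c i • v i ∈ coboundaries d n → c = 0) :
    ClassesFormBasis d v := by
  obtain ⟨b, hb⟩ := exists_basis_quotient ((coboundaries d n).submoduleOf (cocycles d n))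
    (fun i => (⟨v i, hv i⟩ : cocycles d n))
    (fun x => by
      obtain ⟨c, hc⟩ := hspan x x.2
      refine ⟨c, ?_⟩
      change (x : Cochain K n) - ((∑ i, c i • ⟨v i, hv i⟩ : cocycles d n) : Cochain K n) ∈
        coboundaries d n
      simpa using hc)
    (fun c hc => hind c (by
      change ((∑ i, c i • ⟨v i, hv i⟩ : cocycles d n) : Cochain K n) ∈ coboundaries d n at hc
      simpa using hc))
  exact ⟨b, fun i => ⟨hv i, hb i⟩⟩

theorem ClassesFormBasis.finrank_eq {d : Cochain K 2} {n : ℕ} {ι : Type*} [Fintype ι]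
    {v : ι → Cochain K n} (h : ClassesFormBasis d v) :
    Module.finrank K (Cohomology d n) = Fintype.card ι := by
  obtain ⟨b, -⟩ := h
  exact Module.finrank_eq_card_basis b

theorem subsingleton_cohomology {d : Cochain K 2} {n : ℕ}
    (h : ∀ φ ∈ cocycles d n, φ ∈ coboundaries d n) : Subsingleton (Cohomology d n) := by
  refine Submodule.Quotient.subsingleton_iff.2 (eq_top_iff.2 ?_)
  rintro ⟨φ, hφ⟩ -
  exact h φ hφ

/-! ### The cohomology of the five codifferentials -/

/-- The structure constants with `e e = t f`, `e f = c e`, `f e = c' e` and `f f = k f`. -/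
def structConst {A : Type*} (t c c' k : A) (a b : ZMod 2) : A :=
  if a = 0 then (if b = 0 then t else c) else (if b = 0 then c' else k)

section

variable {A : Type*} (t c c' k : A)

@[simp] theorem structConst_zero_zero : structConst t c c' k 0 0 = t := by simp [structConst]

@[simp] theorem structConst_zero_one : structConst t c c' k 0 1 = c := by simp [structConst]

@[simp] theorem structConst_one_zero : structConst t c c' k 1 0 = c' := by simp [structConst]

@[simp] theorem structConst_one_one : structConst t c c' k 1 1 = k := by simp [structConst]

end

section

variable (t c c' k : K)

theorem ofStruct_structConst : ofStruct (structConst t c c' k) =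
    t • phi K ![0, 0] 1 + c • phi K ![0, 1] 0 + c' • phi K ![1, 0] 0 + k • phi K ![1, 1] 1 := by
  simp only [ofStruct, sum_zmod_two]
  simp [CharTwo.add_self_eq_zero, add_assoc]

variable {t c c' k}

theorem isAssoc_structConst (h1 : t * (c + c') = 0) (h2 : t * (c + k) = 0)
    (h3 : c * (c + k) = 0) (h4 : c' * (c' - k) = 0) : IsAssoc (structConst t c c' k) := by
  intro w v u
  rcases zmod_two_cases w with rfl | rfl <;> rcases zmod_two_cases v with rfl | rfl <;>
    rcases zmod_two_cases u with rfl | rfl <;>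
    simp only [CharTwo.add_self_eq_zero, add_zero, zero_add, sgn_zero, sgn_one,
      structConst_zero_zero, structConst_zero_one, structConst_one_zero, structConst_one_one]
  · linear_combination h1
  · linear_combination h2
  · linear_combination h1
  · linear_combination h3
  · linear_combination h1 - h2
  · ring
  · linear_combination -h4
  · ring

end

section

variable {m : ZMod 2 → ZMod 2 → K}

theorem lamW_one_apply_zero (x : W K) : lamW m 1 x 0 = m 1 0 * x 0 := by
  simp [lamW_apply, CharTwo.add_self_eq_zero]

theorem lamW_one_apply_one (x : W K) : lamW m 1 x 1 = m 1 1 * x 1 := by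
  simp [lamW_apply, CharTwo.add_self_eq_zero]

theorem rhoW_one_apply_zero (x : W K) : rhoW m 1 x 0 = m 0 1 * x 0 := by
  simp [rhoW_apply, CharTwo.add_self_eq_zero]

theorem rhoW_one_apply_one (x : W K) : rhoW m 1 x 1 = -(m 1 1 * x 1) := by
  simp [rhoW_apply, CharTwo.add_self_eq_zero]

theorem rhoW_add_lamW_zero_apply_zero (x : W K) :
    (rhoW m 0 x + lamW m 0 x) 0 = -((m 0 1 + m 1 0) * x 1) := by
  simp [rhoW_apply, lamW_apply]
  ring

theorem rhoW_add_lamW_zero_apply_one (x : W K) :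
    (rhoW m 0 x + lamW m 0 x) 1 = 2 * m 0 0 * x 0 := by
  simp [rhoW_apply, lamW_apply, CharTwo.add_self_eq_zero]
  ring

theorem lamW_lamW_one (h4 : m 1 0 * m 1 0 = m 1 1 * m 1 0) (x : W K) :
    lamW m 1 (lamW m 1 x) = m 1 1 • lamW m 1 x := by
  refine zmod_two_fun_ext ?_ ?_
  · simp only [lamW_one_apply_zero, Pi.smul_apply, smul_eq_mul]
    linear_combination x 0 * h4
  · simp only [lamW_one_apply_one, Pi.smul_apply, smul_eq_mul]

/-- The coboundaries have no component `φ^{e^n}_i` if `e` squares to zero and supercommutes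
with `f`. -/
theorem onWords_replicate_of_mem_coboundaries (ht : m 0 0 = 0) (hc : m 1 0 = -m 0 1) {n : ℕ}
    {χ : Cochain K n} (hχ : χ ∈ coboundaries (ofStruct m) n) :
    onWords χ (List.replicate n 0) = 0 := by
  cases n with
  | zero =>
    rw [(Submodule.mem_bot K).1 hχ]
    simp [onWords]
  | succ n =>
    obtain ⟨ψ, rfl⟩ := hχ
    rw [onWords_coboundary m ψ _ (by simp), wordDiff_replicate_zero ht]
    have : ∀ x, rhoW m 0 x + lamW m 0 x = 0 := fun x => zmod_two_fun_ext
      (by rw [rhoW_add_lamW_zero_apply_zero]; simp [hc])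
      (by rw [rhoW_add_lamW_zero_apply_one]; simp [ht])
    rw [this, map_zero, smul_zero]

theorem phi_ePow_mem_cocycles (hc : m 1 0 = -m 0 1) {n : ℕ} {i : ZMod 2}
    (hl : lamW m 1 (wvec K i) = m 1 0 • wvec K i)
    (hr : rhoW m 1 (wvec K i) = -(m 1 0 • wvec K i))
    (h0 : rhoW m 0 (wvec K i) + lamW m 0 (wvec K i) = 0) :
    phi K (ePow n) i ∈ cocycles (ofStruct m) n := by
  rw [mem_cocycles_iff]
  intro I hI
  rw [wordDiff_congr fun J hJ => onWords_phi_ePow i J (by omega)]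
  cases I with
  | nil => rfl
  | cons w I =>
    rw [wordDiff_normalized hc (by rw [map_smul, hl, smul_comm])
      (by rw [map_smul, hr, smul_neg, smul_comm]), map_smul, map_smul,
      ← smul_add, h0]
    simp [normalized]

theorem lamW_one_eq (h : m 1 0 = m 1 1) (x : W K) : lamW m 1 x = m 1 0 • x :=
  zmod_two_fun_ext (lamW_one_apply_zero x) (by rw [lamW_one_apply_one, h]; rfl)

theorem rhoW_one_eq (hc : m 1 0 = -m 0 1) (h : m 1 0 = m 1 1) (x : W K) :
    rhoW m 1 x = -(m 1 0 • x) :=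
  zmod_two_fun_ext (by rw [rhoW_one_apply_zero]; simp [hc])
    (by rw [rhoW_one_apply_one, ← h]; rfl)

/-- If `f` is a unit up to sign, then every cocycle is cohomologous to one that vanishes at the
words that contain `f`. -/
theorem exists_coboundary_of_unital (hm : IsAssoc m) (hk : m 1 1 * m 1 1 = 1)
    (hc : m 1 0 = -m 0 1) (h : m 1 0 = m 1 1) {n : ℕ} {φ : Cochain K n}
    (hφ : φ ∈ cocycles (ofStruct m) n) :
    ∃ χ ∈ coboundaries (ofStruct m) n,
      ∀ I : List (ZMod 2), I.length = n → 1 ∈ I → onWords φ I = onWords χ I := by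
  cases n with
  | zero =>
    refine ⟨0, zero_mem _, fun I hI h1 => ?_⟩
    simp [List.length_eq_zero_iff.1 hI] at h1
  | succ n =>
    obtain ⟨G, hG⟩ := exists_wordDiff_eq_of_mem hk hc (by rw [h]) (lamW_one_eq h)
      (wordDiff_wordDiff hm (isBimod_W hm)) (n + 1) (onWords φ) (mem_cocycles_iff.1 hφ)
    obtain ⟨χ, hχ, hχG⟩ := exists_mem_coboundaries m n G
    exact ⟨χ, hχ, fun I hI h1 => by rw [hG I hI h1, hχG I hI]⟩

/-- The cohomology of the exterior algebra on one odd generator. -/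
theorem classesFormBasis_of_unital_of_sq_zero (hm : IsAssoc m) (hk : m 1 1 * m 1 1 = 1)
    (hc : m 1 0 = -m 0 1) (h : m 1 0 = m 1 1) (ht : m 0 0 = 0) (n : ℕ) :
    ClassesFormBasis (ofStruct m) ![phi K (ePow n) 0, phi K (ePow n) 1] := by
  have h0 : ∀ x, rhoW m 0 x + lamW m 0 x = 0 := fun x => zmod_two_fun_ext
    (by rw [rhoW_add_lamW_zero_apply_zero]; simp [hc])
    (by rw [rhoW_add_lamW_zero_apply_one]; simp [ht])
  refine classesFormBasis_of ?_ ?_ ?_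
  · intro i
    fin_cases i <;>
      exact phi_ePow_mem_cocycles hc (lamW_one_eq h _) (rhoW_one_eq hc h _) (h0 _)
  · intro φ hφ
    obtain ⟨χ, hχ, hφχ⟩ := exists_coboundary_of_unital hm hk hc h hφ
    refine ⟨![onWords (φ - χ) (List.replicate n 0) 0, -onWords (φ - χ) (List.replicate n 0) 1], ?_⟩
    have h2 := eq_add_of_forall_mem hφχ
    convert hχ using 1
    rw [Fin.sum_univ_two, sub_eq_iff_eq_add]
    exact h2
  · intro a ha
    have h3 := onWords_replicate_of_mem_coboundaries ht hc ha
    rw [Fin.sum_univ_two, onWords_add, onWords_smul, onWords_smul] at h3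
    simp only [Matrix.cons_val_zero, Matrix.cons_val_one] at h3
    rw [onWords_phi_ePow _ _ (by simp), onWords_phi_ePow _ _ (by simp)] at h3
    simp only [normalized, one_not_mem_replicate, if_false] at h3
    have e0 := congrFun h3 0
    have e1 := congrFun h3 1
    simp [wvec] at e0 e1
    funext i
    fin_cases i
    · exact e0
    · exact e1

end

section

variable {m : ZMod 2 → ZMod 2 → K}

/-- If a cocycle vanishes at the words that contain `f`, then its value `x` at `e ⋯ e` is
annihilated by the sum of the signed right and left actions of `e`, the supercommutator with `e`. -/
theorem rhoW_add_lamW_of_mem_cocycles (hc : m 1 0 = -m 0 1) (h : m 1 0 = m 1 1) {n : ℕ}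
    {φ : Cochain K n} (hφ : φ ∈ cocycles (ofStruct m) n)
    (hv : ∀ I : List (ZMod 2), I.length = n → 1 ∈ I → onWords φ I = 0) :
    rhoW m 0 (onWords φ (List.replicate n 0)) + lamW m 0 (onWords φ (List.replicate n 0)) = 0 := by
  have h1 := mem_cocycles_iff.1 hφ (List.replicate (n + 1) 0) (by simp)
  rw [wordDiff_congr fun J hJ => onWords_eq_normalized hv (by simpa using hJ), List.replicate_succ,
    wordDiff_normalized hc (lamW_one_eq h _) (rhoW_one_eq hc h _), ← List.replicate_succ] at h1
  simpa only [normalized, one_not_mem_replicate, if_false] using h1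

/-- The center of the Clifford algebra on one odd generator, in degree zero. -/
theorem classesFormBasis_clifford (h2 : (2 : K) ≠ 0) (hc : m 1 0 = -m 0 1)
    (h : m 1 0 = m 1 1) (ht : m 0 0 = 1) :
    ClassesFormBasis (ofStruct m) ![phi K (ePow 0) 1] := by
  refine classesFormBasis_of ?_ ?_ ?_
  · intro i
    fin_cases i
    refine phi_ePow_mem_cocycles hc (lamW_one_eq h _) (rhoW_one_eq hc h _)
      (zmod_two_fun_ext ?_ ?_)
    · rw [rhoW_add_lamW_zero_apply_zero]
      simp [hc]
    · rw [rhoW_add_lamW_zero_apply_one]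
      simp [wvec]
  · intro φ hφ
    have h3 := eq_add_of_forall_mem (φ := φ) (χ := 0) fun I hI h1 => by
      simp [List.length_eq_zero_iff.1 hI] at h1
    have h4 := congrFun (rhoW_add_lamW_of_mem_cocycles hc h hφ fun I hI h1 => by
      simp [List.length_eq_zero_iff.1 hI] at h1) 1
    rw [rhoW_add_lamW_zero_apply_one, ht] at h4
    have h5 : onWords φ (List.replicate 0 0) 0 = 0 := by simpa [h2] using h4
    rw [sub_zero, h5, zero_smul, zero_add, zero_add] at h3
    refine ⟨![-onWords φ (List.replicate 0 0) 1], ?_⟩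
    rw [Fin.sum_univ_one]
    simp only [Matrix.cons_val_zero]
    rw [← h3, sub_self]
    exact zero_mem _
  · intro a ha
    have h3 : a 0 • phi K (ePow 0) 1 = 0 := by
      simpa [coboundaries] using ha
    have h4 := congrArg (fun φ => onWords φ []) h3
    simp only [onWords_smul] at h4
    rw [onWords_phi_ePow (n := 0) _ _ rfl] at h4
    have e1 := congrFun h4 1
    simp [wvec, normalized, onWords] at e1
    funext i
    fin_cases i
    exact e1

/-- The Clifford algebra on one odd generator has no cohomology in positive degrees: the
differential of `φ^{e^n}_e` is `2 ψ^{e^{n+1}}_f` up to sign. -/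
theorem subsingleton_cohomology_clifford (h2 : (2 : K) ≠ 0) (hm : IsAssoc m)
    (hk : m 1 1 * m 1 1 = 1) (hc : m 1 0 = -m 0 1) (h : m 1 0 = m 1 1) (ht : m 0 0 = 1) (n : ℕ) :
    Subsingleton (Cohomology (ofStruct m) (n + 1)) := by
  refine subsingleton_cohomology fun φ hφ => ?_
  obtain ⟨χ, hχ, hφχ⟩ := exists_coboundary_of_unital hm hk hc h hφ
  have hv : ∀ I : List (ZMod 2), I.length = n + 1 → 1 ∈ I → onWords (φ - χ) I = 0 :=
    fun I hI h1 => by rw [onWords_sub, hφχ I hI h1, sub_self]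
  have h4 := congrFun (rhoW_add_lamW_of_mem_cocycles hc h
    (sub_mem hφ (coboundaries_le_cocycles hm _ hχ)) hv) 1
  rw [rhoW_add_lamW_zero_apply_one, ht] at h4
  set x := onWords (φ - χ) (List.replicate (n + 1) 0) with hx
  have h5 : x 0 = 0 := by simpa [h2] using h4
  obtain ⟨χ', hχ', hχ'G⟩ := exists_mem_coboundaries m n (normalized ((x 1 / 2) • wvec K 0))
  have h6 : φ - χ = χ' := by
    refine onWords_injective fun I hI => ?_
    rw [hχ'G I hI, onWords_eq_normalized hv hI, ← hx]
    cases I with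
    | nil => simp at hI
    | cons w I =>
      rw [wordDiff_normalized hc (lamW_one_eq h _) (rhoW_one_eq hc h _)]
      congr 1
      refine zmod_two_fun_ext ?_ ?_
      · rw [rhoW_add_lamW_zero_apply_zero, h5]
        simp [hc]
      · rw [rhoW_add_lamW_zero_apply_one, ht]
        simp [wvec]
        field_simp
  rw [sub_eq_iff_eq_add.1 h6]
  exact add_mem hχ' hχ

/-- For the product of `K` and the null algebra on `e`, every `0`-cochain is a cocycle. -/
theorem classesFormBasis_annihilated_zero (hc : m 0 1 = 0) (hc' : m 1 0 = 0) (ht : m 0 0 = 0) :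
    ClassesFormBasis (ofStruct m) ![phi K (ePow 0) 0, phi K (ePow 0) 1] := by
  refine classesFormBasis_of ?_ ?_ ?_
  · intro i
    rw [mem_cocycles_iff]
    intro I hI
    match I, hI with
    | [w], _ =>
      rw [wordDiff_cons, wordRight_singleton]
      generalize onWords (![phi K (ePow 0) 0, phi K (ePow 0) 1] i) [] = x
      rcases zmod_two_cases w with rfl | rfl
      · refine Eq.trans ?_ (zmod_two_fun_ext (x := rhoW m 0 x + lamW m 0 x) (y := 0)
          (by rw [rhoW_add_lamW_zero_apply_zero]; simp [hc, hc'])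
          (by rw [rhoW_add_lamW_zero_apply_one]; simp [ht]))
        simp
      · refine zmod_two_fun_ext ?_ ?_
        · simp [lamW_one_apply_zero, rhoW_one_apply_zero, hc, hc']
        · simp [lamW_one_apply_one, rhoW_one_apply_one]
  · intro φ _
    have h3 := eq_add_of_forall_mem (φ := φ) (χ := 0) fun I hI h1 => by
      simp [List.length_eq_zero_iff.1 hI] at h1
    rw [sub_zero, zero_add] at h3
    refine ⟨![onWords φ (List.replicate 0 0) 0, -onWords φ (List.replicate 0 0) 1], ?_⟩
    rw [Fin.sum_univ_two]
    simp only [Matrix.cons_val_zero, Matrix.cons_val_one]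
    rw [← h3, sub_self]
    exact zero_mem _
  · intro a ha
    have h3 := onWords_replicate_of_mem_coboundaries ht (by rw [hc, hc', neg_zero]) ha
    rw [Fin.sum_univ_two, onWords_add, onWords_smul, onWords_smul] at h3
    simp only [Matrix.cons_val_zero, Matrix.cons_val_one] at h3
    rw [onWords_phi_ePow _ _ (by simp), onWords_phi_ePow _ _ (by simp)] at h3
    simp only [normalized, one_not_mem_replicate, if_false] at h3
    have e0 := congrFun h3 0
    have e1 := congrFun h3 1
    simp [wvec] at e0 e1
    funext i
    fin_cases i
    · exact e0
    · exact e1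

/-- The positive-degree cohomology of the product of `K` and the null algebra on `e`. -/
theorem classesFormBasis_annihilated_succ (hm : IsAssoc m) (hk : m 1 1 * m 1 1 = 1)
    (hc : m 0 1 = 0) (hc' : m 1 0 = 0) (ht : m 0 0 = 0) (n : ℕ) :
    ClassesFormBasis (ofStruct m) ![phi K (ePow (n + 1)) 0] := by
  have hk0 : m 1 1 ≠ 0 := fun e => by simp [e] at hk
  refine classesFormBasis_of ?_ ?_ ?_
  · intro i
    fin_cases i
    refine phi_ePow_mem_cocycles (by rw [hc, hc', neg_zero]) ?_ ?_ ?_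
    · rw [lamW_wvec]
      simp [hc']
    · rw [rhoW_wvec]
      simp [hc, hc']
    · refine zmod_two_fun_ext ?_ ?_
      · rw [rhoW_add_lamW_zero_apply_zero]
        simp [hc, hc']
      · rw [rhoW_add_lamW_zero_apply_one]
        simp [ht]
  · intro φ hφ
    obtain ⟨G, hG⟩ := exists_wordDiff_eq_of_mem_of_annihilated hk hc hc' hm (isBimod_W hm)
      (fun x => zmod_two_fun_ext (by simp [lamW_apply, hc])
        (by simp [lamW_apply, CharTwo.add_self_eq_zero, ht]))
      (lamW_lamW_one (by simp [hc'])) (gr K 0)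
      (fun w x => by
        rcases zmod_two_cases w with rfl | rfl <;> refine zmod_two_fun_ext ?_ ?_ <;>
          simp [gr_apply, rhoW_apply, CharTwo.add_self_eq_zero, hc, hc', ht])
      (fun x => zmod_two_fun_ext (by rw [lamW_one_apply_zero, hc', zero_mul]; rfl)
        (by rw [lamW_one_apply_one, gr_apply]; simp))
      (fun x hx => by
        have h1 := congrFun hx 1
        rw [lamW_one_apply_one] at h1
        have h2 : x 1 = 0 := by simpa [hk0] using h1
        exact zmod_two_fun_ext (by simp [gr_apply]) (by simp [gr_apply, h2]))
      (n := n) (mem_cocycles_iff.1 hφ)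
    obtain ⟨χ, hχ, hχG⟩ := exists_mem_coboundaries m n G
    have hφχ : ∀ I : List (ZMod 2), I.length = n + 1 → 1 ∈ I → onWords φ I = onWords χ I :=
      fun I hI h1 => by rw [hG I hI h1, hχG I hI]
    have hv : ∀ I : List (ZMod 2), I.length = n + 1 → 1 ∈ I → onWords (φ - χ) I = 0 :=
      fun I hI h1 => by rw [onWords_sub, hφχ I hI h1, sub_self]
    -- the cocycle condition at the word `f e ⋯ e` excludes `φ^{e^n}_f`
    have h3 := mem_cocycles_iff.1 (sub_mem hφ (coboundaries_le_cocycles hm _ hχ))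
      (1 :: 0 :: List.replicate n 0) (by simp)
    rw [wordDiff_one_zero_cons_of_vanish fun J hJ => hv _ (by simpa using hJ) (by simp), hc',
      zero_smul, sub_zero, ← List.replicate_succ] at h3
    have h4 := congrFun h3 1
    rw [lamW_one_apply_one] at h4
    have h5 : onWords (φ - χ) (List.replicate (n + 1) 0) 1 = 0 := by simpa [hk0] using h4
    have h6 := eq_add_of_forall_mem hφχ
    rw [h5, neg_zero, zero_smul, add_zero] at h6
    refine ⟨![onWords (φ - χ) (List.replicate (n + 1) 0) 0], ?_⟩
    convert hχ using 1
    rw [Fin.sum_univ_one, sub_eq_iff_eq_add]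
    exact h6
  · intro a ha
    have h3 := onWords_replicate_of_mem_coboundaries ht (by rw [hc, hc', neg_zero]) ha
    rw [Fin.sum_univ_one, onWords_smul] at h3
    simp only [Matrix.cons_val_zero] at h3
    rw [onWords_phi_ePow _ _ (by simp)] at h3
    simp only [normalized, one_not_mem_replicate, if_false] at h3
    have e0 := congrFun h3 0
    simp [wvec] at e0
    funext i
    fin_cases i
    exact e0

/-- If the left and right eigenvalues of `f` on `e` differ, then all cohomology vanishes. -/
theorem subsingleton_cohomology_of_ne (hm : IsAssoc m) (hk : m 1 1 * m 1 1 = 1)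
    (hne : m 0 1 + m 1 0 ≠ 0) (hck : m 0 1 * m 0 1 = -(m 1 1 * m 0 1))
    (hck' : m 1 0 * m 1 0 = m 1 1 * m 1 0) (ht : m 0 0 = 0) (n : ℕ) :
    Subsingleton (Cohomology (ofStruct m) n) := by
  have hk0 : m 1 1 ≠ 0 := fun e => by simp [e] at hk
  refine subsingleton_cohomology fun φ hφ => ?_
  have hd := mem_cocycles_iff.1 hφ
  match n, φ, hφ, hd with
  | 0, φ, _, hd =>
    refine (Submodule.mem_bot K).2 (onWords_injective fun I hI => ?_)
    rw [List.length_eq_zero_iff.1 hI]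
    have h0 := congrFun (hd [0] rfl) 0
    have h1 := congrFun (hd [1] rfl) 0
    simp only [wordDiff_cons, wordRight_singleton, List.sum_nil, mul_zero, sgn_zero,
      one_smul, rhoW_add_lamW_zero_apply_zero] at h0 h1
    rw [Pi.add_apply, rhoW_one_apply_zero, lamW_one_apply_zero, ← add_mul] at h1
    refine zmod_two_fun_ext ?_ ?_
    · simpa [hne, onWords] using h1
    · simpa [hne, onWords] using h0
  | 1, φ, _, hd =>
    obtain ⟨G, F1, h1, hd1, hv, he⟩ := exists_vanish_one_cons hk (lamW_lamW_one hck')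
      (fun w x => by simpa [CharTwo.add_self_eq_zero] using ((isBimod_W hm).comm 1 w x).symm)
      (wordDiff_wordDiff hm (isBimod_W hm)) (n := 0) hd
    have h3 := congrFun (he [] rfl) 1
    have h4 := congrFun (hd1 [0, 1] rfl) 1
    rw [wordDiff_zero_cons_of_vanish (hv [] rfl), hv [] rfl] at h4
    simp only [if_true, map_zero, smul_zero, wordRight_singleton, Pi.add_apply,
      Pi.neg_apply, Pi.smul_apply, smul_eq_mul, rhoW_one_apply_one] at h4
    rw [lamW_one_apply_one, Pi.smul_apply, smul_eq_mul] at h3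
    -- `F1 (e)` has no component along `f`, by the cocycle condition at `f e` and at `e f`
    have h5 : (m 0 1 + m 1 0) * F1 [0] 1 = 0 := by linear_combination -h3 - h4
    have h6 : F1 [0] 1 = 0 := (mul_eq_zero.1 h5).resolve_left hne
    -- the differential of the `0`-cochain `f` is a multiple of `φ^e_e`
    set y : W K := (-(F1 [0] 0) / (m 0 1 + m 1 0)) • wvec K 1 with hy
    obtain ⟨χ, hχ, hχG⟩ := exists_mem_coboundaries m 0 fun J => G J + y
    convert hχ
    refine onWords_injective fun I hI => ?_
    rw [hχG I hI, wordDiff_add, h1, add_comm, add_right_inj]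
    match I, hI with
    | [w], _ =>
      simp only [wordDiff_cons, wordRight_singleton, List.sum_nil, mul_zero, sgn_zero, one_smul]
      rcases zmod_two_cases w with rfl | rfl
      · refine zmod_two_fun_ext ?_ ?_
        · rw [rhoW_add_lamW_zero_apply_zero, hy]
          simp [wvec]
          field_simp
        · rw [rhoW_add_lamW_zero_apply_one, h6, ht]
          simp
      · rw [hv [] rfl]
        refine zmod_two_fun_ext ?_ ?_
        · rw [Pi.add_apply, rhoW_one_apply_zero, lamW_one_apply_zero, hy]
          simp [wvec]
        · rw [Pi.add_apply, rhoW_one_apply_one, lamW_one_apply_one, neg_add_cancel]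
          rfl
  | n + 2, φ, _, hd =>
    obtain ⟨G, hG⟩ := exists_wordDiff_eq_of_ne hk hne hck hm (isBimod_W hm) (lamW_lamW_one hck') hd
    obtain ⟨χ, hχ, hχG⟩ := exists_mem_coboundaries m (n + 1) G
    convert hχ
    exact onWords_injective fun I hI => by rw [hG I hI, hχG I hI]

end

theorem d1_eq : d1 K = ofStruct (structConst 1 1 (-1) (-1)) := by
  rw [ofStruct_structConst, d1]
  module

theorem d2_eq : d2 K = ofStruct (structConst 0 0 0 1) := by
  rw [ofStruct_structConst, d2]
  module

theorem d3_eq : d3 K = ofStruct (structConst 0 1 0 (-1)) := by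
  rw [ofStruct_structConst, d3]
  module

theorem d4_eq : d4 K = ofStruct (structConst 0 0 1 1) := by
  rw [ofStruct_structConst, d4]
  module

theorem d5_eq : d5 K = ofStruct (structConst 0 1 (-1) (-1)) := by
  rw [ofStruct_structConst, d5]
  module

end OneOneAlg

end

theorem mainTheorem2 (K : Type*) [Field K] (h2 : (2 : K) ≠ 0) (h3 : (3 : K) ≠ 0) :
    -- the five elements of `C^2` are codifferentials and `D ∘ D = 0` for each of them
    (∀ d ∈ ({OneOneAlg.d1 K, OneOneAlg.d2 K, OneOneAlg.d3 K, OneOneAlg.d4 K, OneOneAlg.d5 K} :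
        Set (OneOneAlg.Cochain K 2)),
      OneOneAlg.IsCodifferential d ∧
      ∀ n, OneOneAlg.coboundary d (n + 1) ∘ₗ OneOneAlg.coboundary d n = 0) ∧
    -- `d_1`
    (Module.finrank K (OneOneAlg.Cohomology (OneOneAlg.d1 K) 0) = 1 ∧
      OneOneAlg.ClassesFormBasis (OneOneAlg.d1 K)
        ![OneOneAlg.phi K (OneOneAlg.ePow 0) OneOneAlg.idxF] ∧
      ∀ n, 1 ≤ n → Subsingleton (OneOneAlg.Cohomology (OneOneAlg.d1 K) n)) ∧
    -- `d_2`
    (Module.finrank K (OneOneAlg.Cohomology (OneOneAlg.d2 K) 0) = 2 ∧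
      OneOneAlg.ClassesFormBasis (OneOneAlg.d2 K)
        ![OneOneAlg.phi K (OneOneAlg.ePow 0) OneOneAlg.idxE,
          OneOneAlg.phi K (OneOneAlg.ePow 0) OneOneAlg.idxF] ∧
      ∀ n, 1 ≤ n →
        Module.finrank K (OneOneAlg.Cohomology (OneOneAlg.d2 K) n) = 1 ∧
        OneOneAlg.ClassesFormBasis (OneOneAlg.d2 K)
          ![OneOneAlg.phi K (OneOneAlg.ePow n) OneOneAlg.idxE]) ∧
    -- `d_3`
    ((∀ n, Subsingleton (OneOneAlg.Cohomology (OneOneAlg.d3 K) n)) ∧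
      OneOneAlg.CohomologicallyRigid (OneOneAlg.d3 K)) ∧
    -- `d_4`
    ((∀ n, Subsingleton (OneOneAlg.Cohomology (OneOneAlg.d4 K) n)) ∧
      OneOneAlg.CohomologicallyRigid (OneOneAlg.d4 K)) ∧
    -- `d_5`
    (∀ n, Module.finrank K (OneOneAlg.Cohomology (OneOneAlg.d5 K) n) = 2 ∧
      OneOneAlg.ClassesFormBasis (OneOneAlg.d5 K)
        ![OneOneAlg.phi K (OneOneAlg.ePow n) OneOneAlg.idxE,
          OneOneAlg.phi K (OneOneAlg.ePow n) OneOneAlg.idxF]) := by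
  have a1 : OneOneAlg.IsAssoc (OneOneAlg.structConst (1 : K) 1 (-1) (-1)) :=
    OneOneAlg.isAssoc_structConst (by ring) (by ring) (by ring) (by ring)
  have a2 : OneOneAlg.IsAssoc (OneOneAlg.structConst (0 : K) 0 0 1) :=
    OneOneAlg.isAssoc_structConst (by ring) (by ring) (by ring) (by ring)
  have a3 : OneOneAlg.IsAssoc (OneOneAlg.structConst (0 : K) 1 0 (-1)) :=
    OneOneAlg.isAssoc_structConst (by ring) (by ring) (by ring) (by ring)
  have a4 : OneOneAlg.IsAssoc (OneOneAlg.structConst (0 : K) 0 1 1) :=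
    OneOneAlg.isAssoc_structConst (by ring) (by ring) (by ring) (by ring)
  have a5 : OneOneAlg.IsAssoc (OneOneAlg.structConst (0 : K) 1 (-1) (-1)) :=
    OneOneAlg.isAssoc_structConst (by ring) (by ring) (by ring) (by ring)
  rw [OneOneAlg.d1_eq, OneOneAlg.d2_eq, OneOneAlg.d3_eq, OneOneAlg.d4_eq, OneOneAlg.d5_eq]
  have b1 := OneOneAlg.classesFormBasis_clifford (m := OneOneAlg.structConst (1 : K) 1 (-1) (-1))
    h2 (by simp) (by simp) (by simp)
  have b2 := OneOneAlg.classesFormBasis_annihilated_zero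
    (m := OneOneAlg.structConst (0 : K) 0 0 1) (by simp) (by simp) (by simp)
  have b2' := OneOneAlg.classesFormBasis_annihilated_succ a2 (by simp) (by simp) (by simp) (by simp)
  have b3 := OneOneAlg.subsingleton_cohomology_of_ne a3 (by simp) (by simp) (by simp) (by simp)
    (by simp)
  have b4 := OneOneAlg.subsingleton_cohomology_of_ne a4 (by simp) (by simp) (by simp) (by simp)
    (by simp)
  have b5 := OneOneAlg.classesFormBasis_of_unital_of_sq_zero a5 (by simp) (by simp) (by simp)
    (by simp)
  refine ⟨?_, ⟨by simpa using b1.finrank_eq, b1, fun n hn => ?_⟩,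
    ⟨by simpa using b2.finrank_eq, b2, fun n hn => ?_⟩, ⟨b3, b3 2⟩, ⟨b4, b4 2⟩,
    fun n => ⟨by simpa using (b5 n).finrank_eq, b5 n⟩⟩
  · rintro d (rfl | rfl | rfl | rfl | rfl)
    · exact ⟨OneOneAlg.isCodifferential_ofStruct a1, OneOneAlg.coboundary_comp_coboundary a1⟩
    · exact ⟨OneOneAlg.isCodifferential_ofStruct a2, OneOneAlg.coboundary_comp_coboundary a2⟩
    · exact ⟨OneOneAlg.isCodifferential_ofStruct a3, OneOneAlg.coboundary_comp_coboundary a3⟩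
    · exact ⟨OneOneAlg.isCodifferential_ofStruct a4, OneOneAlg.coboundary_comp_coboundary a4⟩
    · exact ⟨OneOneAlg.isCodifferential_ofStruct a5, OneOneAlg.coboundary_comp_coboundary a5⟩
  · obtain ⟨n, rfl⟩ := Nat.exists_eq_add_of_le' hn
    exact OneOneAlg.subsingleton_cohomology_clifford h2 a1 (by simp) (by simp) (by simp) (by simp) n
  · obtain ⟨n, rfl⟩ := Nat.exists_eq_add_of_le' hn
    exact ⟨by simpa using (b2' n).finrank_eq, b2' n⟩
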